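/- Let $R$ be a Noetherian commutative ring, $m\subset R$ an ideal, and $\hat R=\varprojlim_n R/m^n$ the $m$-adic completion with the topology of the projective limit of the discrete rings $R/m^n$. For a set $X$ let $\hat R[[X]]$ be the set of formal linear combinations $\sum_{x\in X} r_x x$ with $r_x\in\hat R$ such that for every open ideal $I\subset\hat R$ one has $r_x\in I$ for all but finitely many $x$. The functor $X\mapsto\hat R[[X]]$ is a monad on the category of sets: the unit sends $x$ to the linear combination with coefficient $1$ at $x$ and $0$ elsewhere, and the multiplication opens the parentheses, $\sum_{y\in \hat R[[X]]} r_y y\mapsto\sum_{x}\bigl(\sum_y r_y r_{yx}\bigr)x$ where $y=\sum_x r_{yx}x$. An $\hat R$-contramodule is a module (algebra) over this monad. Evaluating finite linear combinations makes every $\hat R$-contramodule an $\hat R$-module; $\hat R$-contramodules form an abelian category $\hat R\text{-contra}$, and restricting scalars along $R\to\hat R$ one obtains an exact forgetful functor $\hat R\text{-contra}\to R\text{-mod}$. **Theorem.** (1) The forgetful functor $\hat R\text{-contra}\to R\text{-mod}$ is fully faithful. (2) Its (essential) image is a full abelian subcategory of $R\text{-mod}$ (it contains $0$ and is closed under finite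 direct sums, kernels and cokernels), and it consists of all the $R$-modules $P$ satisfying any of the following equivalent conditions: (a) for every multiplicatively closed subset $S\subset R$ with $S\cap m\neq\varnothing$, every $R[S^{-1}]$-module $L$ and every $i\ge 0$, one has $\mathrm{Ext}^i_R(L,P)=0$; (b) (provided that $m$ is a maximal ideal of $R$) for every multiplicatively closed subset $S\subset R$ and every $i\ge0$ one has $\mathrm{Ext}^i_R(R[S^{-1}],P)=0$, where nothing is required if both $S\cap m=\varnothing$ and $i=0$; (c) for every $s\in m$ and $i=0,1$, one has $\mathrm{Ext}^i_R(R[s^{-1}],P)=0$. (3) For all $\hat R$-contramodules $P$ and $Q$ and all $i\ge0$, the map $\mathrm{Ext}^i_{\hat R\text{-contra}}(P,Q)\to\mathrm{Ext}^i_R(P,Q)$ induced by the forgetful functor is an isomorphism, where the first $\mathrm{Ext}$ is computed in the abelian category of $\hat R$-contramodules and the second one in that of $R$-modules. -/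

import Mathlib

universe u v w

open CategoryTheory Filter Topology

set_option linter.unusedSectionVars false

namespace Contramodule

/-! ### Families converging to zero in a linearly topologized ring -/

section Families

variable {𝔯 : Type u} [CommRing 𝔯] [UniformSpace 𝔯]

/-- A family of ring elements converges to zero if every neighbourhood of zero contains all but
finitely many of its members. -/
def ConvToZero {ι : Type v} (r : ι → 𝔯) : Prop :=
  Tendsto r cofinite (𝓝 0)

variable [IsUniformAddGroup 𝔯] [IsTopologicalRing 𝔯] [IsLinearTopology 𝔯 𝔯]

/-- Literal form of the convergence condition: for every open ideal, only finitely many members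
of the family lie outside of it. -/
theorem convToZero_iff {ι : Type v} {r : ι → 𝔯} :
    ConvToZero r ↔ ∀ I : Ideal 𝔯, IsOpen (I : Set 𝔯) → {i | r i ∉ I}.Finite := by
  rw [ConvToZero, (IsLinearTopology.hasBasis_open_ideal (R := 𝔯)).tendsto_right_iff]
  simp [Filter.eventually_cofinite]

variable (𝔯) in
/-- The set `𝔯[[X]]` of formal linear combinations `∑ r_x x` of elements of a set `X` whose family
of coefficients converges to zero, with its coefficientwise module structure. -/
def ZeroFam (X : Type v) : Submodule 𝔯 (X → 𝔯) where
  carrier := {r | ConvToZero r}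
  add_mem' {a b} ha hb := by
    have := Tendsto.add (f := a) (g := b) ha hb
    rwa [add_zero] at this
  zero_mem' := tendsto_const_nhds (x := (0 : 𝔯))
  smul_mem' c a ha := by
    have := Tendsto.const_mul (f := a) c ha
    rwa [mul_zero] at this

theorem ConvToZero.mul_left {ι : Type v} {r : ι → 𝔯} (hr : ConvToZero r) (s : ι → 𝔯) :
    ConvToZero (fun i => r i * s i) :=
  IsLinearTopology.tendsto_mul_zero_of_left r s hr

theorem ConvToZero.sigma_mul {ι : Type v} {κ : ι → Type w} {r : ι → 𝔯} (hr : ConvToZero r)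
    {s : ∀ i, κ i → 𝔯} (hs : ∀ i, ConvToZero (s i)) :
    ConvToZero (fun p : Σ i, κ i => r p.1 * s p.1 p.2) := by
  rw [convToZero_iff]
  intro I hI
  refine Set.Finite.subset ((convToZero_iff.1 hr I hI).biUnion fun i _ =>
    (convToZero_iff.1 (hs i) I hI).image (Sigma.mk i)) ?_
  rintro ⟨i, j⟩ h
  exact Set.mem_biUnion (fun h' => h (I.mul_mem_right _ h'))
    ⟨j, fun h' => h (I.mul_mem_left _ h'), rfl⟩

theorem nonarchimedean : NonarchimedeanAddGroup 𝔯 where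
  is_nonarchimedean U hU := by
    obtain ⟨I, hI, hIU⟩ := (IsLinearTopology.hasBasis_open_ideal (R := 𝔯)).mem_iff.1 hU
    exact ⟨⟨I.toAddSubgroup, hI⟩, hIU⟩

variable [CompleteSpace 𝔯]

theorem ConvToZero.summable {ι : Type v} {r : ι → 𝔯} (hr : ConvToZero r) : Summable r :=
  have := nonarchimedean (𝔯 := 𝔯)
  NonarchimedeanAddGroup.summable_of_tendsto_cofinite_zero hr

theorem convToZero_of_summable {ι : Type v} {r : ι → 𝔯} (hr : Summable r) : ConvToZero r :=
  hr.tendsto_cofinite_zero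

variable [T2Space 𝔯]

/-- The image of a formal linear combination `∑ r_i i` under a map `f`: the linear combination
`∑ r_i f(i)`, where the coefficients of all `i` with the same image are added up. -/
noncomputable def push {ι : Type v} {X : Type w} (f : ι → X) (z : ZeroFam 𝔯 ι) :
    ZeroFam 𝔯 X :=
  ⟨fun x => ∑' i : f ⁻¹' {x}, z.1 i,
    convToZero_of_summable ((ConvToZero.summable z.2).hasSum.tsum_fiberwise f).summable⟩

/-- The formal linear combination with coefficient `1` at `x` and coefficient `0` elsewhere. -/
noncomputable def single {X : Type v} (x : X) : ZeroFam 𝔯 X :=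
  letI := Classical.decEq X
  ⟨Pi.single x 1, by
    refine (tendsto_const_nhds (x := (0 : 𝔯))).congr' ?_
    rw [EventuallyEq, eventually_cofinite]
    refine (Set.finite_singleton x).subset fun y hy => ?_
    by_contra hne
    exact hy (Pi.single_eq_of_ne (M := fun _ => 𝔯) hne 1).symm⟩

/-- Opening of parentheses `∑_y r_y y ↦ ∑_x (∑_y r_y r_{yx}) x`, where `y = ∑_x r_{yx} x`. -/
noncomputable def join {X : Type v} (z : ZeroFam 𝔯 (ZeroFam 𝔯 X)) : ZeroFam 𝔯 X :=
  ⟨fun x => ∑' y : ZeroFam 𝔯 X, z.1 y * y.1 x, by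
    have h := ConvToZero.sigma_mul (s := fun (y : ZeroFam 𝔯 X) x => y.1 x) z.2 fun y => y.2
    have h' := ((Equiv.prodComm _ _).summable_iff.2
      ((Equiv.sigmaEquivProd _ _).symm.summable_iff.2 h.summable)).prod
    exact convToZero_of_summable h'⟩

/-- The sum `∑ r_x φ(x)` in the ring. -/
noncomputable def eval {X : Type v} (φ : X → 𝔯) (z : ZeroFam 𝔯 X) : 𝔯 := ∑' x, z.1 x * φ x

theorem eval_single_apply {X : Type v} [DecidableEq X] (x : X) (z : ZeroFam 𝔯 X) :
    eval (Pi.single x 1) z = z.1 x := by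
  rw [eval, tsum_eq_single x]
  · simp
  · intro y hy
    simp [hy]

theorem ext_eval {X : Type v} {z w : ZeroFam 𝔯 X} (h : ∀ φ, eval φ z = eval φ w) : z = w := by
  classical
  ext x
  simpa only [eval_single_apply] using h (Pi.single x 1)

theorem eval_add {X : Type v} (φ : X → 𝔯) (z w : ZeroFam 𝔯 X) :
    eval φ (z + w) = eval φ z + eval φ w := by
  rw [eval, eval, eval, ← (ConvToZero.mul_left z.2 φ).summable.tsum_add
    (ConvToZero.mul_left w.2 φ).summable]
  exact tsum_congr fun x => by simp [add_mul]

theorem eval_smul {X : Type v} (φ : X → 𝔯) (c : 𝔯) (z : ZeroFam 𝔯 X) :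
    eval φ (c • z) = c * eval φ z := by
  rw [eval, eval, ← (ConvToZero.mul_left z.2 φ).summable.tsum_mul_left]
  exact tsum_congr fun x => by simp [mul_assoc]

theorem eval_add_fun {X : Type v} (φ ψ : X → 𝔯) (z : ZeroFam 𝔯 X) :
    eval (fun x => φ x + ψ x) z = eval φ z + eval ψ z := by
  rw [eval, eval, eval, ← (ConvToZero.mul_left z.2 φ).summable.tsum_add
    (ConvToZero.mul_left z.2 ψ).summable]
  exact tsum_congr fun x => by simp [mul_add]

theorem eval_smul_fun {X : Type v} (φ : X → 𝔯) (c : 𝔯) (z : ZeroFam 𝔯 X) :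
    eval (fun x => c * φ x) z = c * eval φ z := by
  rw [eval, eval, ← (ConvToZero.mul_left z.2 φ).summable.tsum_mul_left]
  exact tsum_congr fun x => by ring

theorem eval_single {X : Type v} (φ : X → 𝔯) (x : X) : eval φ (single x) = φ x := by
  classical
  rw [eval, tsum_eq_single x]
  · simp [single]
  · intro y hy
    simp [single, hy]

theorem eval_push {ι : Type v} {X : Type w} (f : ι → X) (φ : X → 𝔯) (z : ZeroFam 𝔯 ι) :
    eval φ (push f z) = eval (fun i => φ (f i)) z := by
  have h := ((ConvToZero.mul_left z.2 fun i => φ (f i)).summable.hasSum.tsum_fiberwise f).tsum_eq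
  rw [eval, eval, ← h]
  refine tsum_congr fun x => ?_
  change (∑' i : f ⁻¹' {x}, z.1 i) * φ x = _
  have hs : Summable fun i : f ⁻¹' {x} => z.1 i := (ConvToZero.summable z.2).subtype _
  rw [← hs.tsum_mul_right]
  refine tsum_congr fun i => ?_
  rw [show f i = x from i.2]

theorem eval_join {X : Type v} (φ : X → 𝔯) (z : ZeroFam 𝔯 (ZeroFam 𝔯 X)) :
    eval φ (join z) = eval (fun y => eval φ y) z := by
  have h : Summable fun p : ZeroFam 𝔯 X × X => z.1 p.1 * p.1.1 p.2 :=
    (Equiv.sigmaEquivProd _ _).symm.summable_iff.2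
      (ConvToZero.sigma_mul (s := fun (y : ZeroFam 𝔯 X) x => y.1 x) z.2 fun y => y.2).summable
  have h' : Summable fun p : ZeroFam 𝔯 X × X => z.1 p.1 * p.1.1 p.2 * φ p.2 :=
    (ConvToZero.mul_left (convToZero_of_summable h) fun p => φ p.2).summable
  calc eval φ (join z) = ∑' x, ∑' y : ZeroFam 𝔯 X, z.1 y * y.1 x * φ x := by
        refine tsum_congr fun x => ?_
        exact (Summable.tsum_mul_right _ (h.comp_injective (Prod.mk_left_injective x))).symm
    _ = ∑' y : ZeroFam 𝔯 X, ∑' x, z.1 y * y.1 x * φ x := Summable.tsum_comm h'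
    _ = _ := by
        refine tsum_congr fun y => ?_
        change _ = z.1 y * ∑' x, y.1 x * φ x
        rw [← Summable.tsum_mul_left _ (ConvToZero.mul_left y.2 φ).summable]
        exact tsum_congr fun x => mul_assoc _ _ _

end Families

/-! ### The monad and its modules -/

section Monad

variable (𝔯 : Type u) [CommRing 𝔯] [UniformSpace 𝔯] [IsUniformAddGroup 𝔯] [IsTopologicalRing 𝔯]
  [IsLinearTopology 𝔯 𝔯] [CompleteSpace 𝔯] [T2Space 𝔯]

/-- The monad `X ↦ 𝔯[[X]]` on the category of sets. -/
noncomputable def contraMonad : Monad (Type u) where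
  obj X := ZeroFam 𝔯 X
  map f := TypeCat.ofHom (push f)
  map_id X := ConcreteCategory.hom_ext _ _ fun z => ext_eval fun φ => eval_push _ φ z
  map_comp f g := ConcreteCategory.hom_ext _ _ fun z => ext_eval fun φ => by
    change eval φ (push _ z) = eval φ (push _ (push _ z))
    simp only [eval_push]
    rfl
  η :=
    { app := fun X => TypeCat.ofHom single
      naturality := fun X Y f => ConcreteCategory.hom_ext _ _ fun x => ext_eval fun φ => by
        change eval φ (single _) = eval φ (push _ (single _))
        simp only [eval_push, eval_single]
        rfl }
  μ :=
    { app := fun X => TypeCat.ofHom join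
      naturality := fun X Y f => ConcreteCategory.hom_ext _ _ fun z => ext_eval fun φ => by
        change eval φ (join (push (push f) z)) = eval φ (push f (join z))
        simp only [eval_push, eval_join] }
  assoc X := ConcreteCategory.hom_ext _ _ fun z => ext_eval fun φ => by
    change eval φ (join (push join z)) = eval φ (join (join z))
    simp only [eval_push, eval_join]
  left_unit X := ConcreteCategory.hom_ext _ _ fun z => ext_eval fun φ => by
    change eval φ (join (single z)) = eval φ z
    simp only [eval_join, eval_single]
  right_unit X := ConcreteCategory.hom_ext _ _ fun z => ext_eval fun φ => by
    change eval φ (join (push single z)) = eval φ z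
    simp only [eval_join, eval_push, eval_single]

/-- The category of `𝔯`-contramodules: modules over the monad `X ↦ 𝔯[[X]]`. -/
abbrev Contra : Type (u + 1) := (contraMonad 𝔯).Algebra


variable {𝔯}

namespace Contra

/-- The contraaction map `π : 𝔯[[P]] → P` of a contramodule. -/
noncomputable def act (P : Contra 𝔯) (z : ZeroFam 𝔯 P.A) : P.A := P.a z

theorem act_single (P : Contra 𝔯) (p : P.A) : act P (single p) = p :=
  ConcreteCategory.congr_hom P.unit p

theorem act_join (P : Contra 𝔯) (z : ZeroFam 𝔯 (ZeroFam 𝔯 P.A)) :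
    act P (join z) = act P (push (act P) z) :=
  ConcreteCategory.congr_hom P.assoc z

theorem map_act {P Q : Contra 𝔯} (f : P ⟶ Q) (z : ZeroFam 𝔯 P.A) :
    f.f (act P z) = act Q (push f.f z) :=
  (ConcreteCategory.congr_hom f.h z).symm

/-- A map commuting with the contraaction maps is a contramodule morphism. -/
noncomputable def homMk {P Q : Contra 𝔯} (f : P.A → Q.A)
    (hf : ∀ z, f (act P z) = act Q (push f z)) : P ⟶ Q where
  f := TypeCat.ofHom f
  h := ConcreteCategory.hom_ext _ _ fun z => (hf z).symm

@[simp] theorem homMk_apply {P Q : Contra 𝔯} (f : P.A → Q.A)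
    (hf : ∀ z, f (act P z) = act Q (push f z)) (p : P.A) : (homMk f hf).f p = f p := rfl

theorem hom_ext' {P Q : Contra 𝔯} {f g : P ⟶ Q} (h : ∀ p, f.f p = g.f p) : f = g :=
  Monad.Algebra.Hom.ext (ConcreteCategory.hom_ext _ _ h)

variable (P : Contra 𝔯)

noncomputable instance : Zero P.A := ⟨act P 0⟩
noncomputable instance : Add P.A := ⟨fun p q => act P (single p + single q)⟩
noncomputable instance : Neg P.A := ⟨fun p => act P ((-1 : 𝔯) • single p)⟩
noncomputable instance : Sub P.A := ⟨fun p q => act P (single p + (-1 : 𝔯) • single q)⟩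
noncomputable instance : SMul 𝔯 P.A := ⟨fun c p => act P (c • single p)⟩
noncomputable instance : SMul ℕ P.A := ⟨fun n p => act P ((n : 𝔯) • single p)⟩
noncomputable instance : SMul ℤ P.A := ⟨fun n p => act P ((n : 𝔯) • single p)⟩

theorem act_lin (c d : 𝔯) (z w : ZeroFam 𝔯 P.A) :
    act P (c • single (act P z) + d • single (act P w)) = act P (c • z + d • w) := by
  have h₁ : push (act P) (c • (single z : ZeroFam 𝔯 _) + d • (single w : ZeroFam 𝔯 _)) =
      c • (single (act P z) : ZeroFam 𝔯 _) + d • (single (act P w) : ZeroFam 𝔯 _) :=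
    ext_eval fun φ => by simp only [eval_push, eval_add, eval_smul, eval_single]
  have h₂ : join (c • single z + d • single w) = c • z + d • w :=
    ext_eval fun φ => by simp only [eval_join, eval_add, eval_smul, eval_single]
  rw [← h₁, ← act_join, h₂]

theorem act_zero : act P 0 = 0 := rfl

theorem act_add (z w : ZeroFam 𝔯 P.A) : act P (z + w) = act P z + act P w := by
  have h := (act_lin P 1 1 z w).symm
  rwa [one_smul, one_smul, one_smul, one_smul] at h

theorem act_smul (c : 𝔯) (z : ZeroFam 𝔯 P.A) : act P (c • z) = c • act P z := by
  have h := (act_lin P c 0 z 0).symm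
  rwa [zero_smul, zero_smul, add_zero, add_zero] at h

theorem act_surjective : Function.Surjective (act P) := fun p => ⟨single p, act_single P p⟩

noncomputable instance : AddCommGroup P.A :=
  Function.Surjective.addCommGroup (act P) (act_surjective P) rfl (act_add P)
    (fun z => by
      rw [← neg_one_smul 𝔯 z]
      exact act_smul P (-1) z)
    (fun z w => by
      rw [sub_eq_add_neg, ← neg_one_smul 𝔯 w]
      have h := (act_lin P 1 (-1) z w).symm
      rwa [one_smul, one_smul] at h)
    (fun z n => by
      rw [← Nat.cast_smul_eq_nsmul 𝔯]
      exact act_smul P n z)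
    (fun z n => by
      rw [← Int.cast_smul_eq_zsmul 𝔯]
      exact act_smul P n z)

/-- The `𝔯`-module structure of a contramodule: finite linear combinations are evaluated by the
contraaction map. -/
noncomputable instance : Module 𝔯 P.A :=
  Function.Surjective.module 𝔯 ⟨⟨act P, act_zero P⟩, act_add P⟩ (act_surjective P)
    (fun c z => act_smul P c z)

/-- Infinite sums are additive in the elements of the contramodule. -/
theorem act_push_lin {ι : Type v} (c d : 𝔯) (f g : ι → P.A) (z : ZeroFam 𝔯 ι) :
    act P (push (fun i => c • f i + d • g i) z) = c • act P (push f z) + d • act P (push g z) := by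
  have h₁ : push (fun i => c • f i + d • g i) z =
      push (act P) (push (fun i => c • single (f i) + d • single (g i)) z) :=
    ext_eval fun φ => by
      simp only [eval_push, act_add, act_smul, act_single]
  have h₂ : join (push (fun i => c • single (f i) + d • single (g i)) z) =
      c • push f z + d • push g z :=
    ext_eval fun φ => by
      simp only [eval_join, eval_push, eval_add, eval_smul, eval_single, eval_add_fun,
        eval_smul_fun]
  rw [h₁, ← act_join, h₂, act_add, act_smul, act_smul]

theorem act_push_add {ι : Type v} (f g : ι → P.A) (z : ZeroFam 𝔯 ι) :
    act P (push (fun i => f i + g i) z) = act P (push f z) + act P (push g z) := by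
  simpa using act_push_lin P 1 1 f g z

theorem act_push_smul {ι : Type v} (c : 𝔯) (f : ι → P.A) (z : ZeroFam 𝔯 ι) :
    act P (push (fun i => c • f i) z) = c • act P (push f z) := by
  simpa using act_push_lin P c 0 f f z

variable {P} {Q : Contra 𝔯}

theorem map_add (f : P ⟶ Q) (p q : P.A) : f.f (p + q) = f.f p + f.f q := by
  have h : push f.f (single p + single q : ZeroFam 𝔯 P.A) = single (f.f p) + single (f.f q) :=
    ext_eval fun φ => by simp only [eval_push, eval_add, eval_single]
  exact (map_act f (single p + single q)).trans (congrArg (act Q) h)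

theorem map_smul (f : P ⟶ Q) (c : 𝔯) (p : P.A) : f.f (c • p) = c • f.f p := by
  have h : push f.f (c • single p : ZeroFam 𝔯 P.A) = c • single (f.f p) :=
    ext_eval fun φ => by simp only [eval_push, eval_smul, eval_single]
  exact (map_act f (c • single p)).trans (congrArg (act Q) h)

/-- A contramodule morphism is linear. -/
noncomputable def toLinearMap (f : P ⟶ Q) : P.A →ₗ[𝔯] Q.A where
  toFun := f.f
  map_add' := map_add f
  map_smul' := map_smul f

noncomputable instance : Add (P ⟶ Q) :=
  ⟨fun f g => homMk (fun p => f.f p + g.f p) fun z => by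
    rw [act_push_add, map_act, map_act]⟩

noncomputable instance : Zero (P ⟶ Q) :=
  ⟨homMk (fun _ => 0) fun z => by simpa using (act_push_smul Q (0 : 𝔯) (fun _ => 0) z).symm⟩

noncomputable instance : Neg (P ⟶ Q) :=
  ⟨fun f => homMk (fun p => (-1 : 𝔯) • f.f p) fun z => by
    rw [act_push_smul, map_act]⟩

theorem add_apply (f g : P ⟶ Q) (p : P.A) : (f + g).f p = f.f p + g.f p := rfl
theorem zero_apply (p : P.A) : (0 : P ⟶ Q).f p = 0 := rfl
theorem neg_apply (f : P ⟶ Q) (p : P.A) : (-f).f p = (-1 : 𝔯) • f.f p := rfl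

noncomputable instance : AddCommGroup (P ⟶ Q) where
  add_assoc f g h := hom_ext' fun p => by simp only [add_apply, add_assoc]
  zero_add f := hom_ext' fun p => by simp only [add_apply, zero_apply, zero_add]
  add_zero f := hom_ext' fun p => by simp only [add_apply, zero_apply, add_zero]
  neg_add_cancel f := hom_ext' fun p => by simp [add_apply, zero_apply, neg_apply]
  add_comm f g := hom_ext' fun p => by simp only [add_apply, add_comm]
  nsmul := nsmulRec
  zsmul := zsmulRec

noncomputable instance : Preadditive (Contra 𝔯) where
  add_comp P Q R f f' g := hom_ext' fun p => by
    change g.f (f.f p + f'.f p) = g.f (f.f p) + g.f (f'.f p)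
    exact map_add g _ _
  comp_add P Q R f g g' := hom_ext' fun p => rfl

end Contra

variable (𝔯) in
/-- The forgetful functor from contramodules over `𝔯` to modules over the abstract ring `𝔯`. -/
noncomputable def contraForget : Contra 𝔯 ⥤ ModuleCat.{u} 𝔯 where
  obj P := ModuleCat.of 𝔯 P.A
  map f := ModuleCat.ofHom (Contra.toLinearMap f)

instance : (contraForget 𝔯).Additive where
  map_add := rfl

instance : (contraForget 𝔯).Faithful where
  map_injective h := Contra.hom_ext' fun p => ConcreteCategory.congr_hom h p

/-! ### Contramodules form an abelian category with an exact forgetful functor -/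

section Abelian

open Limits

instance : HasLimitsOfSize.{u, u} (Contra 𝔯) :=
  hasLimits_of_hasLimits_createsLimits (contraMonad 𝔯).forget

instance : HasFiniteLimits (Contra 𝔯) := inferInstance

theorem contraForget_comp_forget :
    contraForget 𝔯 ⋙ forget (ModuleCat.{u} 𝔯) = (contraMonad 𝔯).forget := rfl

instance : PreservesLimitsOfSize.{u, u} (contraForget 𝔯) :=
  have : PreservesLimitsOfSize.{u, u} (contraForget 𝔯 ⋙ forget (ModuleCat.{u} 𝔯)) :=
    inferInstanceAs (PreservesLimitsOfSize.{u, u} (contraMonad 𝔯).forget)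
  have : ReflectsLimitsOfSize.{u, u} (forget (ModuleCat.{u} 𝔯)) :=
    reflectsLimits_of_reflectsIsomorphisms
  preservesLimits_of_reflects_of_preserves (contraForget 𝔯) (forget (ModuleCat.{u} 𝔯))

instance : PreservesFiniteLimits (contraForget 𝔯) :=
  PreservesLimitsOfSize.preservesFiniteLimits _

instance : (contraForget 𝔯).ReflectsIsomorphisms :=
  have : (contraForget 𝔯 ⋙ forget (ModuleCat.{u} 𝔯)).ReflectsIsomorphisms :=
    inferInstanceAs (contraMonad 𝔯).forget.ReflectsIsomorphisms
  reflectsIsomorphisms_of_comp (contraForget 𝔯) (forget (ModuleCat.{u} 𝔯))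

section Cokernel

variable {P Q : Contra 𝔯} (f : P ⟶ Q)

/-- The quotient of `Q` by the image of `f`, as a module. -/
abbrev CokerCarrier : Type u := Q.A ⧸ LinearMap.range (Contra.toLinearMap f)

/-- Infinite sums in the cokernel are computed by lifting all the elements to `Q`. -/
noncomputable def cokerAct (z : ZeroFam 𝔯 (CokerCarrier f)) : CokerCarrier f :=
  Submodule.Quotient.mk (Contra.act Q (push Quotient.out z))

theorem mk_act (y : ZeroFam 𝔯 Q.A) :
    (Submodule.Quotient.mk (Contra.act Q y) : CokerCarrier f) =
      cokerAct f (push Submodule.Quotient.mk y) := by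
  let mk : Q.A → CokerCarrier f := Submodule.Quotient.mk
  have h : ∀ q : Q.A, ∃ p : P.A, q = (mk q).out + f.f p := fun q => by
    have : mk q = mk (mk q).out := (Quotient.out_eq (mk q)).symm
    obtain ⟨p, hp⟩ := (Submodule.Quotient.eq _).1 this
    exact ⟨p, by rw [show f.f p = q - (mk q).out from hp]; abel⟩
  choose g hg using h
  have h₁ : push (fun q => (mk q).out + f.f (g q)) y = y :=
    ext_eval fun φ => by rw [eval_push]; exact congrArg (fun ψ => eval ψ y) (funext fun q => by
      rw [← hg])
  have h₂ : push Quotient.out (push mk y) = push (fun q => (mk q).out) y :=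
    ext_eval fun φ => by simp only [eval_push]
  have h₃ : push (fun q => f.f (g q)) y = push f.f (push g y) :=
    ext_eval fun φ => by simp only [eval_push]
  rw [cokerAct]
  refine (Submodule.Quotient.eq _).2 ⟨Contra.act P (push g y), ?_⟩
  change f.f _ = Contra.act Q y - Contra.act Q (push Quotient.out (push mk y))
  rw [h₂, Contra.map_act, ← h₃, eq_sub_iff_add_eq, add_comm, ← Contra.act_push_add, h₁]

theorem cokerAct_assoc (z : ZeroFam 𝔯 (ZeroFam 𝔯 (CokerCarrier f))) :
    cokerAct f (join z) = cokerAct f (push (cokerAct f) z) := by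
  let mk : Q.A → CokerCarrier f := Submodule.Quotient.mk
  have hmk : ∀ x : CokerCarrier f, mk x.out = x := fun x => Quotient.out_eq x
  have h₁ : join z = push mk (join (push (push Quotient.out) z)) :=
    ext_eval fun φ => by
      simp only [eval_push, eval_join, hmk]
      rfl
  have h₂ : push (cokerAct f) z =
      push mk (push (Contra.act Q) (push (push Quotient.out) z)) :=
    ext_eval fun φ => by
      simp only [eval_push]
      exact congrArg (fun ψ => eval ψ z) rfl
  rw [h₁, h₂, ← mk_act, ← mk_act, Contra.act_join]

/-- The cokernel of a contramodule morphism. -/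
noncomputable def coker : Contra 𝔯 where
  A := CokerCarrier f
  a := TypeCat.ofHom (cokerAct f)
  unit := ConcreteCategory.hom_ext _ _ fun x => by
    obtain ⟨q, rfl⟩ := Submodule.Quotient.mk_surjective _ x
    have h : (push Submodule.Quotient.mk (single q : ZeroFam 𝔯 Q.A) :
        ZeroFam 𝔯 (CokerCarrier f)) = single (Submodule.Quotient.mk q) :=
      ext_eval fun φ => by simp only [eval_push, eval_single]
    change cokerAct f (single _) = _
    rw [← h, ← mk_act, Contra.act_single]
    rfl
  assoc := ConcreteCategory.hom_ext _ _ fun z => cokerAct_assoc f z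

/-- The projection onto the cokernel. -/
noncomputable def cokerπ : Q ⟶ coker f :=
  Contra.homMk (Q := coker f) (fun q => (Submodule.Quotient.mk q : CokerCarrier f))
    fun z => mk_act f z

theorem comp_cokerπ : f ≫ cokerπ f = 0 := Contra.hom_ext' fun p => by
  have h : (Submodule.Quotient.mk (f.f p) : CokerCarrier f) = Submodule.Quotient.mk (0 : Q.A) :=
    (Submodule.Quotient.eq _).2 ⟨p, (sub_zero _).symm⟩
  change (Contra.toLinearMap (cokerπ f)) (f.f p) = 0
  exact Eq.trans h (Contra.toLinearMap (cokerπ f)).map_zero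

theorem cokerπ_surjective : Function.Surjective (cokerπ f).f :=
  Submodule.Quotient.mk_surjective _

theorem exists_of_cokerπ_eq_zero (q : Q.A) (hq : (cokerπ f).f q = 0) : ∃ p, f.f p = q := by
  have h : (Submodule.Quotient.mk q : CokerCarrier f) = Submodule.Quotient.mk (0 : Q.A) :=
    Eq.trans hq (Contra.toLinearMap (cokerπ f)).map_zero.symm
  obtain ⟨p, hp⟩ := (Submodule.Quotient.eq _).1 h
  exact ⟨p, hp.trans (sub_zero q)⟩

theorem map_eq_of_cokerπ_eq {R : Contra 𝔯} (g : Q ⟶ R) (hg : f ≫ g = 0) {q q' : Q.A}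
    (h : (cokerπ f).f q = (cokerπ f).f q') : g.f q = g.f q' := by
  obtain ⟨p, hp⟩ := (Submodule.Quotient.eq _).1 h
  have h₀ : Contra.toLinearMap g (f.f p) = 0 :=
    congrArg (fun k : P ⟶ R => k.f p) hg
  rw [show f.f p = q - q' from hp, _root_.map_sub, sub_eq_zero] at h₀
  exact h₀

/-- The universal property of the cokernel. -/
noncomputable def cokerDesc {R : Contra 𝔯} (g : Q ⟶ R) (hg : f ≫ g = 0) : coker f ⟶ R :=
  Contra.homMk (P := coker f) (fun x : CokerCarrier f => g.f (Quotient.out x)) fun z => by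
    have h : push (fun x : CokerCarrier f => g.f (Quotient.out x)) z =
        push g.f (push Quotient.out z) := ext_eval fun φ =>
      (eval_push _ φ z).trans ((eval_push g.f φ _).trans (eval_push _ _ z)).symm
    refine Eq.trans ?_ (congrArg (Contra.act R) h.symm)
    rw [← Contra.map_act]
    exact map_eq_of_cokerπ_eq f g hg (Quotient.out_eq (cokerAct f z))

theorem cokerπ_desc {R : Contra 𝔯} (g : Q ⟶ R) (hg : f ≫ g = 0) :
    cokerπ f ≫ cokerDesc f g hg = g :=
  Contra.hom_ext' fun q => map_eq_of_cokerπ_eq f g hg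
    (Quotient.out_eq (Submodule.Quotient.mk q : CokerCarrier f))

/-- The cokernel cofork is a colimit. -/
noncomputable def cokerIsColimit :
    IsColimit (CokernelCofork.ofπ (cokerπ f) (comp_cokerπ f)) :=
  CokernelCofork.IsColimit.ofπ _ _ (fun g hg => cokerDesc f g hg) (fun g hg => cokerπ_desc f g hg)
    fun g hg k hk => Contra.hom_ext' fun x => by
      obtain ⟨q, rfl⟩ := cokerπ_surjective f x
      have h := hk.trans (cokerπ_desc f g hg).symm
      exact congrArg (fun k : Q ⟶ _ => k.f q) h

instance : HasCokernel f := ⟨⟨⟨_, cokerIsColimit f⟩⟩⟩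

instance : HasCokernels (Contra 𝔯) where

instance : PreservesColimit (parallelPair f 0) (contraForget 𝔯) := by
  refine preservesColimit_of_preserves_colimit_cocone (cokerIsColimit f) ?_
  refine (CokernelCofork.isColimitMapCoconeEquiv _ _).2 ?_
  have hS : (contraForget 𝔯).map f ≫ (contraForget 𝔯).map (cokerπ f) = 0 := by
    rw [← Functor.map_comp, comp_cokerπ, Functor.map_zero]
  let S : ShortComplex (ModuleCat.{u} 𝔯) := ⟨_, _, hS⟩
  have : Epi S.g := (ModuleCat.epi_iff_surjective _).2 (cokerπ_surjective f)
  have hE : S.Exact := (ShortComplex.moduleCat_exact_iff S).2 fun q hq =>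
    exists_of_cokerπ_eq_zero f q hq
  exact hE.gIsCokernel

end Cokernel

instance : HasFiniteBiproducts (Contra 𝔯) := HasFiniteBiproducts.of_hasFiniteProducts

instance {P Q : Contra 𝔯} (f : P ⟶ Q) : IsIso (Abelian.coimageImageComparison f) := by
  have := IsIso.of_isIso_fac_right (Abelian.PreservesCoimage.hom_coimageImageComparison
    (contraForget 𝔯) f).symm
  exact isIso_of_reflects_iso _ (contraForget 𝔯)

noncomputable instance : Abelian (Contra 𝔯) := Abelian.ofCoimageImageComparisonIsIso

instance : PreservesFiniteColimits (contraForget 𝔯) :=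
  have : ∀ {P Q : Contra 𝔯} (f : P ⟶ Q), PreservesColimit (parallelPair f 0) (contraForget 𝔯) :=
    fun _ => inferInstance
  Functor.preservesFiniteColimits_of_preservesCokernels _

instance : HasExt.{u + 1} (Contra 𝔯) := HasExt.standard _

end Abelian

end Monad

/-! ### The adic completion as a topological ring -/

section Adic

variable {R : Type u} [CommRing R] (m : Ideal R)

/-- The topology (and uniformity) of the projective limit `lim R/mⁿ` of discrete rings. -/
noncomputable instance : UniformSpace (AdicCompletion m R) :=
  ⨅ n, UniformSpace.comap (AdicCompletion.eval m R n) ⊥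

instance : IsUniformAddGroup (AdicCompletion m R) :=
  isUniformAddGroup_iInf fun n =>
    letI : UniformSpace (R ⧸ (m ^ n • ⊤ : Submodule R R)) := ⊥
    have : IsUniformAddGroup (R ⧸ (m ^ n • ⊤ : Submodule R R)) := inferInstance
    IsUniformAddGroup.comap (AdicCompletion.eval m R n)

theorem eval_eq_of_le {k n : ℕ} (h : k ≤ n) {x y : AdicCompletion m R}
    (hxy : x.val n = y.val n) : x.val k = y.val k := by
  rw [← x.2 h, ← y.2 h]
  exact congrArg _ hxy

theorem hasBasis_uniformity : (uniformity (AdicCompletion m R)).HasBasis (fun _ : ℕ => True)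
    (fun n => {p | p.1.val n = p.2.val n}) := by
  have h : uniformity (AdicCompletion m R) =
      ⨅ n, 𝓟 {p : AdicCompletion m R × AdicCompletion m R | p.1.val n = p.2.val n} := by
    refine iInf_uniformity.trans (iInf_congr fun n => ?_)
    refine (comap_principal).trans ?_
    rfl
  rw [h]
  exact hasBasis_iInf_principal (directed_of_isDirected_le fun k n hkn p hp =>
    eval_eq_of_le m hkn hp)

/-- The kernel of the projection `lim R/mⁿ → R/mⁿ`. -/
def kerEval (n : ℕ) : Ideal (AdicCompletion m R) where
  carrier := {x | x.val n = 0}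
  add_mem' {a b} ha hb := by
    change a.val n + b.val n = 0
    rw [show a.val n = 0 from ha, show b.val n = 0 from hb, add_zero]
  zero_mem' := rfl
  smul_mem' c x hx := by
    change (c * x).val n = 0
    rw [AdicCompletion.val_mul, show x.val n = 0 from hx, mul_zero]

theorem hasBasis_nhds_zero : (𝓝 (0 : AdicCompletion m R)).HasBasis (fun _ : ℕ => True)
    (fun n => (kerEval m n : Set (AdicCompletion m R))) := by
  have h := nhds_basis_uniformity (hasBasis_uniformity m) (x := (0 : AdicCompletion m R))
  exact h

instance : IsLinearTopology (AdicCompletion m R) (AdicCompletion m R) :=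
  IsLinearTopology.mk_of_hasBasis _ (hasBasis_nhds_zero m)

instance : IsTopologicalRing (AdicCompletion m R) := by
  have hl (c : AdicCompletion m R) : Tendsto (c * ·) (𝓝 0) (𝓝 0) :=
    ((hasBasis_nhds_zero m).tendsto_iff (hasBasis_nhds_zero m)).2 fun n _ =>
      ⟨n, trivial, fun x hx => (kerEval m n).mul_mem_left c hx⟩
  refine IsTopologicalRing.of_addGroup_of_nhds_zero ?_ hl fun c => ?_
  · rw [((hasBasis_nhds_zero m).prod_self.tendsto_iff (hasBasis_nhds_zero m))]
    exact fun n _ => ⟨n, trivial, fun x hx => (kerEval m n).mul_mem_left _ hx.2⟩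
  · simpa only [mul_comm] using hl c

instance : T2Space (AdicCompletion m R) := by
  have : T0Space (AdicCompletion m R) := t0Space_iff_uniformity.2 fun x y h =>
    AdicCompletion.ext fun n => h _ ((hasBasis_uniformity m).mem_of_mem (i := n) trivial)
  infer_instance

instance : CompleteSpace (AdicCompletion m R) := by
  refine ⟨fun {f} hf => ?_⟩
  have h := ((hasBasis_uniformity m).cauchy_iff.1 hf)
  have := h.1
  choose t ht htt using fun n => h.2 n trivial
  have hne : ∀ n, (t n).Nonempty := fun n => nonempty_of_mem (ht n)
  choose x hx using hne
  let L : AdicCompletion m R := ⟨fun n => (x n).val n, fun {k n} hkn => by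
    obtain ⟨y, hy⟩ := nonempty_of_mem (inter_mem (ht k) (ht n))
    have h₁ : (x k).val k = y.val k := htt k _ (hx k) _ hy.1
    have h₂ : (x n).val n = y.val n := htt n _ (hx n) _ hy.2
    exact (congrArg _ h₂).trans ((y.2 hkn).trans h₁.symm)⟩
  refine ⟨L, ?_⟩
  rw [(nhds_basis_uniformity' (hasBasis_uniformity m) (x := L)).ge_iff]
  intro n _
  exact mem_of_superset (ht n) fun y hy => htt n _ (hx n) _ hy

/-- The forgetful functor from contramodules over the `m`-adic completion of `R` to `R`-modules:
the forgetful functor to modules over the completion followed by restriction of scalars. -/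
noncomputable abbrev forgetToBase : Contra (AdicCompletion m R) ⥤ ModuleCat.{u} R :=
  contraForget (AdicCompletion m R) ⋙
    ModuleCat.restrictScalars (algebraMap R (AdicCompletion m R))

/-! ### The Ext conditions -/

variable {m}

open Limits Abelian

/-- `Ext^i_R(L, P) = 0` for all `i ≥ 0`, all multiplicative subsets `S` of `R` meeting `m`, and all
`R[S⁻¹]`-modules `L`. -/
def ExtCondA (m : Ideal R) (P : ModuleCat.{u} R) : Prop :=
  ∀ S : Submonoid R, ((S : Set R) ∩ (m : Set R)).Nonempty →
    ∀ (L : ModuleCat.{u} (Localization S)) (i : ℕ),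
      Subsingleton (Ext.{u} ((ModuleCat.restrictScalars (algebraMap R (Localization S))).obj L) P i)

/-- `Ext^i_R(R[S⁻¹], P) = 0` for all multiplicative subsets `S` of `R` and all `i ≥ 0`, with the
only exception of `S ∩ m = ∅` and `i = 0`. -/
def ExtCondB (m : Ideal R) (P : ModuleCat.{u} R) : Prop :=
  ∀ (S : Submonoid R) (i : ℕ), ¬ ((S : Set R) ∩ (m : Set R) = ∅ ∧ i = 0) →
    Subsingleton (Ext.{u} (ModuleCat.of R (Localization S)) P i)

/-- `Ext^i_R(R[s⁻¹], P) = 0` for all `s ∈ m` and `i = 0, 1`. -/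
def ExtCondC (m : Ideal R) (P : ModuleCat.{u} R) : Prop :=
  ∀ s ∈ m, ∀ i : ℕ, i = 0 ∨ i = 1 →
    Subsingleton (Ext.{u} (ModuleCat.of R (Localization.Away s)) P i)

end Adic

end Contramodule

-- The pivot is a condition on a single element `s`: every sequence `p` in `P` is `n ↦ q n - s • q
-- (n + 1)` for a unique `q` (`UniqueTelescope`). Since `R[s⁻¹]` is the colimit of `R → R → ⋯` along
-- `s`, it is the cokernel of an injective endomorphism of a free module, and the condition says
-- that `Hom` and `Ext¹` from `R[s⁻¹]` to `P` vanish. Dimension shifting then kills `Ext` in all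
-- degrees from every module on which `s` is invertible (`UniqueTelescope.subsingleton_ext`). A
-- contramodule satisfies the condition for each `s ∈ m`, with `q n = ∑ s ^ k p (n + k)`
-- (`uniqueTelescope_of_contra`).
--
-- Conversely, let `P` satisfy it for all `s ∈ m`. The key claim (`isFreeAgainst`) is that `Hom` and
-- `Ext` into `P` cannot distinguish the module of formal combinations over the completion from the
-- free module on `X`. The generators of `m` are added one at a time, starting from the zero ideal,
-- for which the two modules coincide. Passing from `I` to `I + (s)` is a map whose kernel and
-- cokernel have `s` invertible, by Artin–Rees, so `P` does not see it.
--
-- Hence finite linear combinations in `P` extend uniquely to an infinite summation, which is the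
-- contramodule structure; linear maps preserve it automatically, which gives fullness; and free
-- contramodules are projective contramodules that are acyclic for `Ext_R` into contramodules, which
-- compares the `Ext` groups. For maximal `m`, elements outside `m` act invertibly on `P`, and this
-- reduces the remaining part of condition (b) to `Ext` over the localization.

universe t t'

namespace Contramodule

open Abelian

/-! ### Vanishing of Ext in short exact sequences of modules. -/

section ExtModules

variable {R : Type u} [CommRing R] {A B C : Type u} [AddCommGroup A] [Module R A]
  [AddCommGroup B] [Module R B] [AddCommGroup C] [Module R C] {P : ModuleCat.{u} R}

theorem subsingleton_ext_zero_iff :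
    Subsingleton (Ext.{u} (ModuleCat.of R A) P 0) ↔ ∀ f : A →ₗ[R] P, f = 0 := by
  rw [Ext.homEquiv₀.subsingleton_congr, ModuleCat.homEquiv.subsingleton_congr]
  exact ⟨fun _ f => Subsingleton.elim _ _, fun h => ⟨fun f g => (h f).trans (h g).symm⟩⟩

theorem subsingleton_ext_congr (e : A ≃ₗ[R] B) (i : ℕ)
    (h : Subsingleton (Ext.{u} (ModuleCat.of R A) P i)) :
    Subsingleton (Ext.{u} (ModuleCat.of R B) P i) := by
  refine subsingleton_of_forall_eq 0 fun x => ?_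
  rw [← Ext.mk₀_id_comp x, ← e.toModuleIso.inv_hom_id, ← Ext.mk₀_comp_mk₀_assoc,
    Subsingleton.elim ((Ext.mk₀ e.toModuleIso.hom).comp x (zero_add i)) 0, Ext.comp_zero]

variable {f : A →ₗ[R] B} {g : B →ₗ[R] C}

theorem shortExact_of_exact (hf : Function.Injective f) (hg : Function.Surjective g)
    (hfg : Function.Exact f g) :
    (ShortComplex.mk (ModuleCat.ofHom f) (ModuleCat.ofHom g)
      (by ext x; exact hfg.apply_apply_eq_zero x)).ShortExact where
  exact := (ShortComplex.ShortExact.moduleCat_exact_iff_function_exact _).2 hfg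
  mono_f := (ModuleCat.mono_iff_injective _).2 hf
  epi_g := (ModuleCat.epi_iff_surjective _).2 hg

theorem subsingleton_ext_right (hf : Function.Injective f) (hg : Function.Surjective g)
    (hfg : Function.Exact f g) {i : ℕ} (hA : Subsingleton (Ext.{u} (ModuleCat.of R A) P i))
    (hB : Subsingleton (Ext.{u} (ModuleCat.of R B) P (i + 1))) :
    Subsingleton (Ext.{u} (ModuleCat.of R C) P (i + 1)) := by
  refine subsingleton_of_forall_eq 0 fun x => ?_
  obtain ⟨y, rfl⟩ := Ext.contravariant_sequence_exact₃ (shortExact_of_exact hf hg hfg) P x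
    (hB.elim _ _) (add_comm 1 i)
  rw [hA.elim y 0, Ext.comp_zero]

theorem subsingleton_ext_middle (hf : Function.Injective f) (hg : Function.Surjective g)
    (hfg : Function.Exact f g) {i : ℕ} (hA : Subsingleton (Ext.{u} (ModuleCat.of R A) P i))
    (hC : Subsingleton (Ext.{u} (ModuleCat.of R C) P i)) :
    Subsingleton (Ext.{u} (ModuleCat.of R B) P i) := by
  refine subsingleton_of_forall_eq 0 fun x => ?_
  obtain ⟨y, rfl⟩ := Ext.contravariant_sequence_exact₂ (shortExact_of_exact hf hg hfg) P x
    (hA.elim _ _)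
  rw [hC.elim y 0, Ext.comp_zero]

theorem exists_extension (hf : Function.Injective f) (hg : Function.Surjective g)
    (hfg : Function.Exact f g) (hC : Subsingleton (Ext.{u} (ModuleCat.of R C) P 1))
    (h : A →ₗ[R] P) : ∃ h' : B →ₗ[R] P, h' ∘ₗ f = h := by
  obtain ⟨y, hy⟩ := Ext.contravariant_sequence_exact₁ (shortExact_of_exact hf hg hfg) P
    (Ext.mk₀ (ModuleCat.ofHom h : ModuleCat.of R A ⟶ P)) (add_zero 1) (hC.elim _ _)
  obtain ⟨k, rfl⟩ := (Ext.mk₀_bijective _ _).2 y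
  rw [Ext.mk₀_comp_mk₀] at hy
  exact ⟨k.hom, congrArg ModuleCat.Hom.hom ((Ext.mk₀_bijective _ _).1 hy)⟩

/-- Partial converse to `exists_extension`: when `Ext¹(B, P) = 0`, every class in `Ext¹(C, P)` is
the connecting image of a map `A → P`, and maps that extend to `B` have zero image. -/
theorem subsingleton_ext_one (hf : Function.Injective f) (hg : Function.Surjective g)
    (hfg : Function.Exact f g) (hB : Subsingleton (Ext.{u} (ModuleCat.of R B) P 1))
    (h : ∀ h : A →ₗ[R] P, ∃ h' : B →ₗ[R] P, h' ∘ₗ f = h) :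
    Subsingleton (Ext.{u} (ModuleCat.of R C) P 1) := by
  refine subsingleton_of_forall_eq 0 fun x => ?_
  obtain ⟨y, rfl⟩ := Ext.contravariant_sequence_exact₃ (shortExact_of_exact hf hg hfg) P x
    (hB.elim _ _) (add_zero 1)
  obtain ⟨k, rfl⟩ := (Ext.mk₀_bijective _ _).2 y
  obtain ⟨h', hh'⟩ := h k.hom
  have : k = ModuleCat.ofHom f ≫ (ModuleCat.ofHom h' : ModuleCat.of R B ⟶ P) :=
    ModuleCat.hom_ext hh'.symm
  rw [this, ← Ext.mk₀_comp_mk₀]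
  exact ShortComplex.ShortExact.extClass_comp_assoc _ _

theorem subsingleton_ext_of_free [Module.Free R A] (i : ℕ) :
    Subsingleton (Ext.{u} (ModuleCat.of R A) P (i + 1)) :=
  have : Projective (ModuleCat.of R A) :=
    (IsProjective.iff_projective _).1 (inferInstanceAs (Module.Projective R A))
  Ext.subsingleton_of_projective _ _ _

theorem exact_subtype_rangeRestrict (f : A →ₗ[R] B) :
    Function.Exact (LinearMap.ker f).subtype f.rangeRestrict :=
  LinearMap.exact_iff.2 (by rw [LinearMap.ker_rangeRestrict, Submodule.range_subtype])

/-- A linear map whose kernel and cokernel have no extensions by `P` in any degree induces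
a bijection on homomorphisms into `P`. -/
theorem bijective_precomp_of_ker_coker (f : A →ₗ[R] B)
    (hK : ∀ i, Subsingleton (Ext.{u} (ModuleCat.of R (LinearMap.ker f)) P i))
    (hC : ∀ i, Subsingleton (Ext.{u} (ModuleCat.of R (B ⧸ LinearMap.range f)) P i)) :
    Function.Bijective fun h : B →ₗ[R] P => h ∘ₗ f := by
  constructor
  · refine (injective_iff_map_eq_zero (LinearMap.lcomp R P f)).2 fun h hh => ?_
    have h₀ : LinearMap.range f ≤ LinearMap.ker h := by
      rintro _ ⟨x, rfl⟩
      exact LinearMap.congr_fun hh x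
    rw [← (LinearMap.range f).liftQ_mkQ h h₀, subsingleton_ext_zero_iff.1 (hC 0)
      ((LinearMap.range f).liftQ h h₀), LinearMap.zero_comp]
  · intro h
    -- `Hom(ker f, P) = 0` lets `h` descend to the image of `f`; the vanishing of `Ext¹` on the
    -- cokernel extends it to `B`.
    have h₀ : LinearMap.ker f ≤ LinearMap.ker h := fun x hx =>
      LinearMap.congr_fun (subsingleton_ext_zero_iff.1 (hK 0)
        (h ∘ₗ (LinearMap.ker f).subtype)) ⟨x, hx⟩
    obtain ⟨k, hk⟩ := exists_extension (P := P) (LinearMap.range f).injective_subtype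
      (LinearMap.range f).mkQ_surjective (LinearMap.exact_subtype_mkQ _) (hC 1)
      ((LinearMap.ker f).liftQ h h₀ ∘ₗ f.quotKerEquivRange.symm)
    refine ⟨k, LinearMap.ext fun x => ?_⟩
    have h₁ := LinearMap.congr_fun hk (f.quotKerEquivRange (Submodule.Quotient.mk x))
    simpa using h₁

/-- Factor `f` through its image: the kernel and `A` control the image, then the image and the
cokernel control `B`. -/
theorem subsingleton_ext_of_ker_coker (f : A →ₗ[R] B)
    (hK : ∀ i, Subsingleton (Ext.{u} (ModuleCat.of R (LinearMap.ker f)) P i))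
    (hC : ∀ i, Subsingleton (Ext.{u} (ModuleCat.of R (B ⧸ LinearMap.range f)) P i)) {i : ℕ}
    (hA : Subsingleton (Ext.{u} (ModuleCat.of R A) P (i + 1))) :
    Subsingleton (Ext.{u} (ModuleCat.of R B) P (i + 1)) :=
  subsingleton_ext_middle (LinearMap.range f).injective_subtype
    (LinearMap.range f).mkQ_surjective (LinearMap.exact_subtype_mkQ _)
    (subsingleton_ext_right (LinearMap.ker f).injective_subtype f.surjective_rangeRestrict
      (exact_subtype_rangeRestrict f) (hK i) hA) (hC _)

end ExtModules

/-! ### Telescopes, the localization `R[s⁻¹]`, and orthogonality to modules with `s` invertible. -/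

section Telescope

variable {R : Type u} [CommRing R]

/-- Every sequence `p` of elements of `P` can be written uniquely as `n ↦ q n - s • q (n + 1)`. -/
def UniqueTelescope (s : R) (P : Type v) [AddCommGroup P] [Module R P] : Prop :=
  ∀ p : ℕ → P, ∃! q : ℕ → P, ∀ n, q n - s • q (n + 1) = p n

theorem UniqueTelescope.eq_zero {s : R} {P : Type v} [AddCommGroup P] [Module R P]
    (h : UniqueTelescope s P) {q : ℕ → P} (hq : ∀ n, q n = s • q (n + 1)) : q = 0 :=
  (h 0).unique (fun n => sub_eq_zero.2 (hq n)) fun n => by simp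

/-- The endomorphism `e_(n,x) ↦ e_(n,x) - s e_(n+1,x)` of a free module. -/
noncomputable def teleMap (s : R) (X : Type v) : (ℕ × X →₀ R) →ₗ[R] (ℕ × X →₀ R) :=
  LinearMap.id - s • Finsupp.lmapDomain R R (Prod.map Nat.succ id)

theorem teleMap_single (s : R) {X : Type v} (n : ℕ) (x : X) :
    teleMap s X (Finsupp.single (n, x) 1) =
      Finsupp.single (n, x) 1 - s • Finsupp.single (n + 1, x) 1 := by
  simp [teleMap]

theorem teleMap_injective (s : R) (X : Type v) : Function.Injective (teleMap s X) := by
  refine (injective_iff_map_eq_zero _).2 fun a ha => ?_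
  have hinj : Function.Injective (Prod.map Nat.succ id : ℕ × X → ℕ × X) :=
    Nat.succ_injective.prodMap Function.injective_id
  -- An element of the kernel is `s` times its own shift, so its coefficients vanish by induction,
  -- starting at index `0`, which the shift does not reach.
  have h (p : ℕ × X) : a p = s * Finsupp.mapDomain (Prod.map Nat.succ id) a p := by
    have := DFunLike.congr_fun ha p
    simpa [teleMap, sub_eq_zero] using this
  ext ⟨n, x⟩
  induction n with
  | zero => rw [h, Finsupp.mapDomain_of_notMem_range _ _ (by simp), mul_zero]; rfl
  | succ n ih =>
    rw [h, show (n + 1, x) = Prod.map Nat.succ id (n, x) from rfl,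
      Finsupp.mapDomain_apply hinj, ih]
    exact mul_zero s

/-- The direct sum of copies of the colimit of `R → R → ⋯` with transition maps `s`. -/
abbrev Tele (s : R) (X : Type v) : Type (max u v) := (ℕ × X →₀ R) ⧸ LinearMap.range (teleMap s X)

/-- The generators of the telescope. -/
noncomputable def Tele.gen (s : R) {X : Type v} (n : ℕ) (x : X) : Tele s X :=
  Submodule.Quotient.mk (Finsupp.single (n, x) 1)

theorem Tele.smul_gen (s : R) {X : Type v} (n : ℕ) (x : X) :
    s • Tele.gen s (n + 1) x = Tele.gen s n x := by
  refine ((Submodule.Quotient.eq (LinearMap.range (teleMap s X))).2 ?_).symm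
  exact ⟨Finsupp.single (n, x) 1, teleMap_single s n x⟩

theorem Tele.hom_ext (s : R) {X : Type v} {M : Type w} [AddCommGroup M] [Module R M]
    {f g : Tele s X →ₗ[R] M} (h : ∀ n x, f (Tele.gen s n x) = g (Tele.gen s n x)) : f = g :=
  Submodule.linearMap_qext _ (Finsupp.lhom_ext' fun p => LinearMap.ext_ring (h p.1 p.2))

/-- The linear map from the telescope determined by a compatible family. -/
noncomputable def Tele.lift (s : R) {X : Type v} {M : Type w} [AddCommGroup M] [Module R M]
    (φ : ℕ → X → M) (hφ : ∀ n x, s • φ (n + 1) x = φ n x) : Tele s X →ₗ[R] M :=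
  Submodule.liftQ _ (Finsupp.linearCombination R fun p : ℕ × X => φ p.1 p.2) <| by
    rw [LinearMap.range_le_ker_iff]
    refine Finsupp.lhom_ext' fun p => LinearMap.ext_ring ?_
    simp [teleMap, hφ]

theorem Tele.lift_gen (s : R) {X : Type v} {M : Type w} [AddCommGroup M] [Module R M]
    (φ : ℕ → X → M) (hφ : ∀ n x, s • φ (n + 1) x = φ n x) (n : ℕ) (x : X) :
    Tele.lift s φ hφ (Tele.gen s n x) = φ n x := by
  simp [Tele.lift, Tele.gen]

theorem Tele.bijective_smul (s : R) (X : Type v) :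
    Function.Bijective fun x : Tele s X => s • x := by
  -- The inverse of `s` moves each generator one step along the telescope.
  let σ : Tele s X →ₗ[R] Tele s X :=
    Tele.lift s (fun n x => Tele.gen s (n + 1) x) fun n x => Tele.smul_gen s _ x
  have h : ∀ t, s • σ t = t := LinearMap.congr_fun (f := s • σ) (g := LinearMap.id)
    (Tele.hom_ext s fun n x => by simp [σ, Tele.lift_gen, Tele.smul_gen])
  exact ⟨Function.LeftInverse.injective (g := σ) fun t => by rw [← h t, h, _root_.map_smul, h],
    fun t => ⟨σ t, h t⟩⟩

/-- Here `φ n` is `s⁻ⁿ`; these are the compatible families that map a telescope to `L`. -/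
theorem exists_seq_of_bijective_smul {s : R} {L : Type u} [AddCommGroup L] [Module R L]
    (hL : Function.Bijective fun x : L => s • x) :
    ∃ φ : ℕ → L →ₗ[R] L, (∀ x, φ 0 x = x) ∧ ∀ n x, s • φ (n + 1) x = φ n x := by
  let e : L ≃ₗ[R] L := LinearEquiv.ofBijective (LinearMap.lsmul R L s) hL
  refine ⟨fun n => (e.symm : L →ₗ[R] L) ^ n, fun x => rfl, fun n x => ?_⟩
  change s • ((e.symm : L →ₗ[R] L) ^ (n + 1)) x = _
  rw [pow_succ']
  exact e.apply_symm_apply _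

variable {P : ModuleCat.{u} R} {s : R}

/-- If `P` has unique telescopes for `s`, then it is right orthogonal to all the modules on which
`s` acts invertibly. -/
theorem UniqueTelescope.subsingleton_ext (hP : UniqueTelescope s P) (i : ℕ) {L : Type u}
    [AddCommGroup L] [Module R L] (hL : Function.Bijective fun x : L => s • x) :
    Subsingleton (Ext.{u} (ModuleCat.of R L) P i) := by
  induction i generalizing L with
  | zero =>
    obtain ⟨φ, hφ₀, hφ⟩ := exists_seq_of_bijective_smul hL
    refine subsingleton_ext_zero_iff.2 fun f => LinearMap.ext fun x => ?_
    have h := hP.eq_zero (q := fun n => f (φ n x)) fun n => by rw [← _root_.map_smul, hφ]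
    simpa [hφ₀] using congrFun h 0
  | succ i ih =>
    obtain ⟨φ, hφ₀, hφ⟩ := exists_seq_of_bijective_smul hL
    -- A direct sum of copies of `R[s⁻¹]` covers `L`. On the kernel `s` is again invertible, so the
    -- induction hypothesis applies to it one degree lower.
    let g : Tele s L →ₗ[R] L := Tele.lift s (fun n x => φ n x) hφ
    have hg : Function.Surjective g := fun x =>
      ⟨Tele.gen s 0 x, (Tele.lift_gen s _ hφ 0 x).trans (hφ₀ x)⟩
    refine subsingleton_ext_right (LinearMap.ker g).injective_subtype hg
      (LinearMap.exact_subtype_ker_map g) (ih ⟨?_, ?_⟩) ?_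
    · exact fun x y h => Subtype.ext ((Tele.bijective_smul s L).1 (congrArg Subtype.val h))
    · rintro ⟨x, hx⟩
      obtain ⟨y, rfl⟩ := (Tele.bijective_smul s L).2 x
      refine ⟨⟨y, ?_⟩, rfl⟩
      exact hL.1 (by simpa using hx)
    -- The telescope has a free resolution of length one. Only degree one needs an argument, and
    -- there extending along `teleMap` amounts to solving telescope equations in `P`.
    · have hex := LinearMap.exact_map_mkQ_range (teleMap s L)
      cases i with
      | zero =>
        refine subsingleton_ext_one (teleMap_injective s L) (Submodule.mkQ_surjective _) hex
          (subsingleton_ext_of_free 0) fun h => ?_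
        choose q hq _ using fun x : L => hP fun n => h (Finsupp.single (n, x) 1)
        refine ⟨Finsupp.linearCombination R fun p : ℕ × L => q p.2 p.1,
          Finsupp.lhom_ext' fun p => LinearMap.ext_ring ?_⟩
        simp [teleMap, hq]
      | succ i =>
        exact subsingleton_ext_right (teleMap_injective s L) (Submodule.mkQ_surjective _) hex
          (subsingleton_ext_of_free i) (subsingleton_ext_of_free (i + 1))

theorem bijective_smul_localization {S : Submonoid R} (hs : s ∈ S) (L : Type w) [AddCommGroup L]
    [Module R L] [Module (Localization S) L] [IsScalarTower R (Localization S) L] :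
    Function.Bijective fun x : L => s • x := by
  have h : IsUnit (algebraMap R (Localization S) s) :=
    IsLocalization.map_units (Localization S) (⟨s, hs⟩ : S)
  rw [show (fun x : L => s • x) = fun x => h.unit • x from
    funext fun x => (algebraMap_smul (Localization S) s x).symm]
  exact MulAction.bijective h.unit

/-- The telescope on one generator is the localization. -/
noncomputable def teleEquivLocalization (s : R) :
    Tele s PUnit.{u + 1} ≃ₗ[R] Localization.Away s :=
  have h : ∀ x : Submonoid.powers s,
      IsUnit (algebraMap R (Module.End R (Tele s PUnit.{u + 1})) x) := by
    rintro ⟨_, n, rfl⟩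
    change IsUnit (algebraMap R (Module.End R (Tele s PUnit.{u + 1})) (s ^ n))
    rw [_root_.map_pow]
    exact ((Module.End.isUnit_iff _).2 (Tele.bijective_smul s PUnit.{u + 1})).pow n
  have hφ := exists_seq_of_bijective_smul (bijective_smul_localization
    (Submonoid.mem_powers s) (Localization.Away s))
  let φ := hφ.choose
  let f : Tele s PUnit.{u + 1} →ₗ[R] Localization.Away s :=
    Tele.lift s (fun n _ => φ n 1) fun n _ => hφ.choose_spec.2 n 1
  let g := IsLocalizedModule.lift (Submonoid.powers s) (Algebra.linearMap R (Localization.Away s))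
    (LinearMap.toSpanSingleton R _ (Tele.gen s 0 PUnit.unit)) h
  have hf : ∀ n, f (Tele.gen s n PUnit.unit) = φ n 1 := fun n => Tele.lift_gen s _ _ n _
  have hg : g 1 = Tele.gen s 0 PUnit.unit := by
    rw [← _root_.map_one (algebraMap R (Localization.Away s))]
    exact (IsLocalizedModule.lift_apply _ (Algebra.linearMap R (Localization.Away s)) _ h 1).trans
      (one_smul R _)
  LinearEquiv.ofLinearMap f g
    (IsLocalizedModule.linearMap_ext (Submonoid.powers s)
      (Algebra.linearMap R (Localization.Away s)) (Algebra.linearMap R (Localization.Away s))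
      (LinearMap.ext_ring (by simpa [hg, hf] using hφ.choose_spec.1 1)))
    (Tele.hom_ext s fun n x => by
      rw [LinearMap.comp_apply, hf, LinearMap.id_apply]
      induction n with
      | zero => rw [show φ 0 1 = 1 from hφ.choose_spec.1 1, hg]
      | succ n ih =>
        refine (Tele.bijective_smul s _).1 ?_
        change s • g _ = s • _
        rw [← _root_.map_smul, show s • φ (n + 1) 1 = φ n 1 from hφ.choose_spec.2 n 1, ih,
          Tele.smul_gen])

/-- `Ext¹ = 0` extends `e_n ↦ p n` along `teleMap`, which yields a solution. The difference of two
solutions is a compatible family, that is, a map from the telescope, so `Hom = 0` yields uniqueness.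
-/
theorem uniqueTelescope_of_subsingleton_ext
    (h₀ : Subsingleton (Ext.{u} (ModuleCat.of R (Localization.Away s)) P 0))
    (h₁ : Subsingleton (Ext.{u} (ModuleCat.of R (Localization.Away s)) P 1)) :
    UniqueTelescope s P := by
  replace h₀ := subsingleton_ext_congr (teleEquivLocalization s).symm 0 h₀
  replace h₁ := subsingleton_ext_congr (teleEquivLocalization s).symm 1 h₁
  intro p
  obtain ⟨k, hk⟩ := exists_extension (P := P) (teleMap_injective s PUnit.{u + 1})
    (Submodule.mkQ_surjective _) (LinearMap.exact_map_mkQ_range _) h₁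
    (Finsupp.linearCombination R fun q : ℕ × PUnit.{u + 1} => p q.1)
  refine ⟨fun n => k (Finsupp.single (n, PUnit.unit) 1), fun n => ?_, fun q hq => ?_⟩
  · have := LinearMap.congr_fun hk (Finsupp.single (n, PUnit.unit) 1)
    rw [LinearMap.comp_apply, teleMap_single, _root_.map_sub, _root_.map_smul,
      Finsupp.linearCombination_single, one_smul] at this
    exact this
  · have hq' : ∀ n, q n - s • q (n + 1) = k (Finsupp.single (n, PUnit.unit) 1) -
      s • k (Finsupp.single (n + 1, PUnit.unit) 1) := fun n => by
      have := LinearMap.congr_fun hk (Finsupp.single (n, PUnit.unit) 1)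
      rw [LinearMap.comp_apply, teleMap_single, _root_.map_sub, _root_.map_smul,
        Finsupp.linearCombination_single, one_smul] at this
      exact (hq n).trans this.symm
    have := subsingleton_ext_zero_iff.1 h₀ (Tele.lift s
      (fun n _ => q n - k (Finsupp.single (n, PUnit.unit) 1)) fun n _ => by
        rw [smul_sub, sub_eq_sub_iff_sub_eq_sub, ← neg_sub, ← neg_sub (k _), neg_inj]
        exact hq' n)
    funext n
    have h := LinearMap.congr_fun this (Tele.gen s n PUnit.unit)
    rw [Tele.lift_gen] at h
    exact sub_eq_zero.1 h

end Telescope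

/-! ### Artin–Rees estimates for adjoining `s` to an ideal. -/

section ArtinRees

variable {R : Type u} [CommRing R]

theorem sup_span_pow_le (I : Ideal R) (s : R) (k : ℕ) :
    (I ⊔ Ideal.span {s}) ^ k ≤ I ^ k ⊔ Ideal.span {s} * (I ⊔ Ideal.span {s}) ^ (k - 1) := by
  set J := I ⊔ Ideal.span {s} with hJ
  induction k with
  | zero => simp
  | succ k ih =>
    rw [pow_succ', Nat.add_sub_cancel, hJ, Ideal.sup_mul, ← hJ]
    refine sup_le ((Ideal.mul_mono_right ih).trans ?_) le_sup_right
    rw [Ideal.mul_sup, ← pow_succ', mul_left_comm]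
    refine sup_le_sup_left (Ideal.mul_mono_right ?_) _
    cases k with
    | zero => simp
    | succ k => rw [pow_succ' J k]; exact Ideal.mul_mono_left le_sup_left

theorem exists_sub_mul_mem_pow {I : Ideal R} {s : R} {k : ℕ} {y : R}
    (hy : y ∈ (I ⊔ Ideal.span {s}) ^ k) :
    ∃ v ∈ (I ⊔ Ideal.span {s}) ^ (k - 1), y - s * v ∈ I ^ k := by
  obtain ⟨a, ha, b, hb, rfl⟩ := Submodule.mem_sup.1 (sup_span_pow_le I s k hy)
  obtain ⟨v, hv, rfl⟩ := Ideal.mem_span_singleton_mul.1 hb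
  exact ⟨v, hv, by simpa using ha⟩

variable [IsNoetherianRing R]

theorem exists_artinRees_span (I : Ideal R) (s : R) :
    ∃ c : ℕ, ∀ k t, s * t ∈ I ^ k → ∃ d ∈ I ^ (k - c), s * d = s * t := by
  obtain ⟨c, hc⟩ := I.exists_pow_inf_eq_pow_smul (Ideal.span {s})
  refine ⟨c, fun k t ht => ?_⟩
  rcases le_or_gt c k with h | h
  · have h₁ : s * t ∈ I ^ k • ⊤ ⊓ Ideal.span {s} :=
      ⟨by simpa using ht, Ideal.mul_mem_right _ _ (Ideal.mem_span_singleton_self s)⟩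
    rw [hc k h] at h₁
    have h₂ : s * t ∈ I ^ (k - c) * Ideal.span {s} :=
      Submodule.smul_mono le_rfl inf_le_right h₁
    rw [mul_comm] at h₂
    exact Ideal.mem_span_singleton_mul.1 h₂
  -- For `k < c` truncated subtraction gives `I ^ 0 = ⊤`, so the condition on `d` is empty.
  · exact ⟨t, by simp [Nat.sub_eq_zero_of_le h.le], rfl⟩

/-- On the annihilator `N` of `s` the powers of `J = I + (s)` and of `I` act alike, because `s N =
0`. Artin–Rees for `J` therefore puts `J ^ k ∩ N` inside `J ^ (k - c) N ⊆ I ^ (k - c)`. -/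
theorem exists_artinRees_annihilator (I : Ideal R) (s : R) :
    ∃ c : ℕ, ∀ k t, t ∈ (I ⊔ Ideal.span {s}) ^ k → s * t = 0 → t ∈ I ^ (k - c) := by
  set J := I ⊔ Ideal.span {s} with hJ
  let N : Ideal R := LinearMap.ker (LinearMap.mul R R s)
  have hN (k : ℕ) : J ^ k * N ≤ I ^ k * N := by
    induction k with
    | zero => exact le_rfl
    | succ k ih =>
      rw [pow_succ', mul_assoc, hJ, Ideal.sup_mul, ← hJ]
      refine sup_le ?_ ?_
      · rw [pow_succ', mul_assoc]
        exact Ideal.mul_mono_right ih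
      · rw [mul_left_comm]
        have h₀ : Ideal.span {s} * N = ⊥ := by
          rw [eq_bot_iff]
          intro x hx
          obtain ⟨y, hy, rfl⟩ := Ideal.mem_span_singleton_mul.1 hx
          exact hy
        rw [h₀]
        simp
  obtain ⟨c, hc⟩ := J.exists_pow_inf_eq_pow_smul N
  refine ⟨c, fun k t ht hst => ?_⟩
  rcases le_or_gt c k with h | h
  · have h₁ : t ∈ J ^ k • ⊤ ⊓ N := ⟨by simpa using ht, hst⟩
    rw [hc k h] at h₁
    exact Ideal.mul_le_left (hN _ (Submodule.smul_mono le_rfl inf_le_right h₁))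
  · simp [Nat.sub_eq_zero_of_le h.le]

end ArtinRees

/-! ### Formal combinations as limits of finite ones. -/

section Represent

variable {R : Type u} [CommRing R] {I J : Ideal R} {X : Type v}

theorem mk_eq_mk_iff {k : ℕ} {r r' : R} :
    (Submodule.Quotient.mk r : R ⧸ (I ^ k • ⊤ : Submodule R R)) = Submodule.Quotient.mk r' ↔
      r - r' ∈ I ^ k := by
  rw [Submodule.Quotient.eq]
  simp

variable (I X) in
/-- Formal linear combinations over the completion, as a module over the base ring. -/
def FormalComb : Type (max u v) := ZeroFam (AdicCompletion I R) X

noncomputable instance : AddCommGroup (FormalComb I X) :=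
  inferInstanceAs (AddCommGroup (ZeroFam (AdicCompletion I R) X))

noncomputable instance : Module R (FormalComb I X) :=
  Module.compHom (ZeroFam (AdicCompletion I R) X) (algebraMap R (AdicCompletion I R))

namespace FormalComb

/-- The coefficients of a formal linear combination modulo the powers of the ideal. -/
def val (z : FormalComb I X) (k : ℕ) (x : X) : R ⧸ (I ^ k • ⊤ : Submodule R R) :=
  (Subtype.val (p := (· ∈ ZeroFam (AdicCompletion I R) X)) z x).val k

theorem ext_val {z w : FormalComb I X} (h : ∀ k x, z.val k x = w.val k x) : z = w :=
  Subtype.ext (funext fun x => AdicCompletion.ext fun k => h k x)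

theorem val_add (z w : FormalComb I X) (k : ℕ) (x : X) :
    (z + w).val k x = z.val k x + w.val k x := rfl

theorem val_smul (r : R) (z : FormalComb I X) (k : ℕ) (x : X) :
    (r • z).val k x = r • z.val k x :=
  congrArg (fun y : AdicCompletion I R => y.val k) (Algebra.smul_def (A := AdicCompletion I R) r
    (Subtype.val (p := (· ∈ ZeroFam (AdicCompletion I R) X)) z x)).symm

theorem finite_val_ne_zero (z : FormalComb I X) (k : ℕ) : {x | z.val k x ≠ 0}.Finite := by
  have h : ∀ᶠ x in cofinite, Subtype.val (p := (· ∈ ZeroFam (AdicCompletion I R) X)) z x ∈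
      (kerEval I k : Set (AdicCompletion I R)) :=
    z.2 ((hasBasis_nhds_zero I).mem_of_mem trivial)
  exact h

theorem val_of_le (z : FormalComb I X) {k n : ℕ} (h : k ≤ n) (x : X) {r : R}
    (hr : z.val n x = Submodule.Quotient.mk r) : z.val k x = Submodule.Quotient.mk r :=
  ((Subtype.val (p := (· ∈ ZeroFam (AdicCompletion I R) X)) z x).2 h).symm.trans
    (congrArg (AdicCompletion.transitionMap I R h) hr :)

theorem exists_val_eq {a : ℕ → X → R} (ha : ∀ k x, a (k + 1) x - a k x ∈ I ^ k)
    (hfin : ∀ k, {x | a k x ∉ I ^ k}.Finite) :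
    ∃ z : FormalComb I X, ∀ k x, z.val k x = Submodule.Quotient.mk (a k x) := by
  have h' : ∀ {k n : ℕ}, k ≤ n → ∀ x, a n x - a k x ∈ I ^ k := fun {k n} hkn x => by
    induction n, hkn using Nat.le_induction with
    | base => simp
    | succ n hkn ih =>
      rw [← sub_add_sub_cancel _ (a n x)]
      exact add_mem (Ideal.pow_le_pow_right hkn (ha n x)) ih
  refine ⟨⟨fun x => ⟨fun k => Submodule.Quotient.mk (a k x), fun {k n} hkn => ?_⟩, ?_⟩,
    fun k x => rfl⟩
  · exact mk_eq_mk_iff.2 (h' hkn x)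
  · refine (hasBasis_nhds_zero I).tendsto_right_iff.2 fun k _ => ?_
    refine (hfin k).subset fun x hx h₀ => hx ?_
    exact mk_eq_mk_iff.2 (by rwa [sub_zero])

end FormalComb

/-- A sequence of finite linear combinations represents a formal linear combination over the
completion if its `k`-th member agrees with it modulo `I ^ k`. -/
def Represents (a : ℕ → X →₀ R) (z : FormalComb I X) : Prop :=
  ∀ k x, z.val k x = Submodule.Quotient.mk (a k x)

theorem exists_represents (z : FormalComb I X) : ∃ a : ℕ → X →₀ R, Represents a z := by
  classical
  refine ⟨fun k => Finsupp.onFinset (z.finite_val_ne_zero k).toFinset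
    (fun x => if z.val k x = 0 then 0 else Quotient.out (z.val k x)) fun x hx => ?_,
    fun k x => ?_⟩
  · simp only [Set.Finite.mem_toFinset, Set.mem_ofPred_eq]
    intro h
    simp [h] at hx
  · rw [Finsupp.onFinset_apply]
    split_ifs with h
    · rw [h]; rfl
    · exact (Quotient.out_eq _).symm

theorem Represents.sub_mem {a : ℕ → X →₀ R} {z : FormalComb I X}
    (h : Represents a z) {k n : ℕ} (hkn : k ≤ n) (x : X) : a n x - a k x ∈ I ^ k := by
  rw [← mk_eq_mk_iff, ← h k x, z.val_of_le hkn x (h n x)]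

/-- The coefficients of the limit tend to zero with no further hypothesis: modulo `I ^ k` the limit
agrees with `a k`, whose support is finite. -/
theorem exists_of_cauchy {a : ℕ → X →₀ R} (h : ∀ k x, a (k + 1) x - a k x ∈ I ^ k) :
    ∃ z : FormalComb I X, Represents a z :=
  FormalComb.exists_val_eq (a := fun k => a k) h fun k =>
    (a k).hasFiniteSupport.subset fun _ hx h₀ => hx (h₀ ▸ zero_mem _)

/-- Reindexing absorbs the constant loss of precision caused by Artin–Rees. -/
theorem exists_of_cauchy_shift {a : ℕ → X →₀ R} (c : ℕ)
    (h : ∀ k x, a (k + 1) x - a k x ∈ I ^ (k - c)) :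
    ∃ z : FormalComb I X, Represents (fun k => a (k + c)) z :=
  exists_of_cauchy fun k x => by simpa [add_right_comm] using h (k + c) x

theorem Represents.shift {a : ℕ → X →₀ R} {z : FormalComb I X}
    (h : Represents a z) (c : ℕ) : Represents (fun k => a (k + c)) z := fun k x =>
  (h k x).trans (mk_eq_mk_iff.2 (h.sub_mem (Nat.le_add_right k c) x)).symm

theorem Represents.add {a b : ℕ → X →₀ R} {z w : FormalComb I X}
    (hz : Represents a z) (hw : Represents b w) : Represents (fun k => a k + b k) (z + w) :=
  fun k x => (FormalComb.val_add z w k x).trans (congrArg₂ (· + ·) (hz k x) (hw k x))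

theorem Represents.smul {a : ℕ → X →₀ R} {z : FormalComb I X}
    (hz : Represents a z) (r : R) : Represents (fun k => r • a k) (r • z) :=
  fun k x => (FormalComb.val_smul r z k x).trans (congrArg (r • ·) (hz k x))

theorem Represents.eq_iff {a b : ℕ → X →₀ R} {z w : FormalComb I X}
    (hz : Represents a z) (hw : Represents b w) : z = w ↔ ∀ k x, a k x - b k x ∈ I ^ k := by
  simp only [← mk_eq_mk_iff, ← hz _ _, ← hw _ _]
  exact ⟨fun h k x => by rw [h], FormalComb.ext_val⟩

theorem represents_zero : Represents (fun _ => 0) (0 : FormalComb I X) :=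
  fun _ _ => rfl

theorem Represents.eq_zero_iff {a : ℕ → X →₀ R} {z : FormalComb I X}
    (hz : Represents a z) : z = 0 ↔ ∀ k x, a k x ∈ I ^ k := by
  simpa using hz.eq_iff represents_zero

theorem exists_changeIdeal (h : I ≤ J) (z : FormalComb I X) :
    ∃ w : FormalComb J X, ∀ a, Represents a z → Represents a w := by
  obtain ⟨a, ha⟩ := exists_represents z
  obtain ⟨w, hw⟩ := exists_of_cauchy (a := a) (I := J) fun k x =>
    Ideal.pow_right_mono h k (ha.sub_mem k.le_succ x)
  refine ⟨w, fun b hb k x => (hw k x).trans (mk_eq_mk_iff.2 (Ideal.pow_right_mono h k ?_))⟩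
  exact (ha.eq_iff hb).1 rfl k x

/-- The change of completion map on formal linear combinations. -/
noncomputable def changeIdeal (h : I ≤ J) (X : Type v) : FormalComb I X →ₗ[R] FormalComb J X where
  toFun z := (exists_changeIdeal h z).choose
  map_add' z w := by
    obtain ⟨a, ha⟩ := exists_represents z
    obtain ⟨b, hb⟩ := exists_represents w
    exact (((exists_changeIdeal h (z + w)).choose_spec _ (ha.add hb)).eq_iff
      (((exists_changeIdeal h z).choose_spec _ ha).add
        ((exists_changeIdeal h w).choose_spec _ hb))).2 fun k x => by simp
  map_smul' r z := by
    obtain ⟨a, ha⟩ := exists_represents z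
    exact (((exists_changeIdeal h (r • z)).choose_spec _ (ha.smul r)).eq_iff
      (((exists_changeIdeal h z).choose_spec _ ha).smul r)).2 fun k x => by simp

theorem Represents.changeIdeal {a : ℕ → X →₀ R} {z : FormalComb I X}
    (ha : Represents a z) (h : I ≤ J) : Represents a (changeIdeal h X z) :=
  (exists_changeIdeal h z).choose_spec a ha

variable (I X) in
/-- Finite linear combinations as formal linear combinations over the completion. -/
noncomputable def ofFinsupp : (X →₀ R) →ₗ[R] FormalComb I X where
  toFun a := (exists_of_cauchy (a := fun _ => a) fun k x => by simp).choose
  map_add' a b := by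
    refine ((Exists.choose_spec _ : Represents (fun _ => a + b) _).eq_iff
      ((Exists.choose_spec _ : Represents (fun _ => a) _).add
        (Exists.choose_spec _ : Represents (fun _ => b) _))).2 fun k x => by simp
  map_smul' r a := by
    refine ((Exists.choose_spec _ : Represents (fun _ => r • a) _).eq_iff
      ((Exists.choose_spec _ : Represents (fun _ => a) _).smul r)).2 fun k x => by simp

theorem represents_ofFinsupp (a : X →₀ R) : Represents (fun _ => a) (ofFinsupp I X a) :=
  (exists_of_cauchy (a := fun _ => a) fun k x => by simp).choose_spec

theorem ofFinsupp_single (x : X) :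
    ofFinsupp I X (Finsupp.single x 1) = (single x : ZeroFam (AdicCompletion I R) X) := by
  classical
  refine FormalComb.ext_val fun k y => (represents_ofFinsupp _ k y).trans ?_
  change _ = ((Pi.single x 1 : X → AdicCompletion I R) y).val k
  rcases eq_or_ne y x with rfl | h
  · simp only [Finsupp.single_eq_same, Pi.single_eq_same]
    rfl
  · simp only [Finsupp.single_eq_of_ne h, Pi.single_eq_of_ne h]
    rfl

theorem changeIdeal_comp_ofFinsupp (h : I ≤ J) :
    changeIdeal h X ∘ₗ ofFinsupp I X = ofFinsupp J X :=
  LinearMap.ext fun a => (((represents_ofFinsupp a).changeIdeal h).eq_iff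
    (represents_ofFinsupp a)).2 fun k x => by simp

theorem ofFinsupp_bot_bijective : Function.Bijective (ofFinsupp (⊥ : Ideal R) X) := by
  constructor
  · refine (injective_iff_map_eq_zero _).2 fun a ha => Finsupp.ext fun x => ?_
    simpa using (represents_ofFinsupp a).eq_zero_iff.1 ha 1 x
  · intro z
    obtain ⟨a, ha⟩ := exists_represents z
    -- The term `a 0` carries no information, since `⊥ ^ 0 = ⊤`; from index `1` on the sequence is
    -- constant.
    refine ⟨a 1, ((represents_ofFinsupp _).eq_iff (ha.shift 1)).2 fun k x => ?_⟩
    have h := ha.sub_mem (Nat.le_add_left 1 k) x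
    rw [pow_one, Ideal.mem_bot, sub_eq_zero] at h
    simp [h]

/-- Coefficientwise choice that keeps finite support: `h₀` permits choosing `0` wherever `y`
vanishes. -/
theorem exists_finsupp_forall (y : X →₀ R) (Q : R → R → Prop) (h₀ : Q 0 0)
    (h : ∀ x, ∃ u, Q (y x) u) : ∃ u : X →₀ R, ∀ x, Q (y x) (u x) := by
  classical
  choose u hu using h
  refine ⟨Finsupp.onFinset y.support (fun x => if y x = 0 then 0 else u x) fun x hx => ?_,
    fun x => ?_⟩
  · rw [Finsupp.mem_support_iff]
    intro h
    simp [h] at hx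
  · rw [Finsupp.onFinset_apply]
    split_ifs with h
    · rwa [h]
    · exact hu x

end Represent

/-! ### Passing from `I` to `J = I + (s)`: bijectivity on `s`-torsion and modulo `s`. -/

section AddGenerator

variable {R : Type u} [CommRing R] [IsNoetherianRing R] {I J : Ideal R} {s : R} {X : Type v}

/-- The approximate quotients `w k` need not converge, but `s (w (k + 1) - w k) ∈ I ^ k`. Artin–Rees
replaces each increment by a small one with the same multiple by `s`, and the corrected sequence
converges. -/
theorem exists_smul_eq_of_mem {z : FormalComb I X} {a : ℕ → X →₀ R}
    (ha : Represents a z) (h : ∀ k x, ∃ w, a k x - s * w ∈ I ^ k) :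
    ∃ z' : FormalComb I X, s • z' = z := by
  obtain ⟨c, hc⟩ := exists_artinRees_span I s
  choose w hw using fun k => exists_finsupp_forall (a k) (fun r w => r - s * w ∈ I ^ k) (by simp)
    (h k)
  have hd (k : ℕ) : ∃ d : X →₀ R, ∀ x, d x ∈ I ^ (k - c) ∧
      s * d x = s * (w (k + 1) - w k) x := by
    refine exists_finsupp_forall (w (k + 1) - w k) (fun r d => d ∈ I ^ (k - c) ∧ s * d = s * r)
      (by simp) fun x => ?_
    refine hc k _ ?_
    have h₁ := Ideal.pow_le_pow_right (Nat.le_succ k) (hw (k + 1) x)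
    have h₂ := ha.sub_mem (Nat.le_succ k) x
    have h₃ := add_mem (sub_mem (hw k x) h₁) h₂
    convert h₃ using 1
    simp only [Finsupp.sub_apply, Nat.succ_eq_add_one]
    ring
  choose d hd hd' using hd
  let b : ℕ → X →₀ R := fun k => w 0 + ∑ j ∈ Finset.range k, d j
  have hb : ∀ k x, s * b k x = s * w k x := fun k x => by
    induction k with
    | zero => simp [b]
    | succ k ih =>
      have : b (k + 1) x = b k x + d k x := by simp [b, Finset.sum_range_succ, add_assoc]
      rw [this, mul_add, ih, hd', ← mul_add, Finsupp.sub_apply, add_sub_cancel]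
  obtain ⟨z', hz'⟩ := exists_of_cauchy_shift (a := b) (I := I) c fun k x => by
    have : b (k + 1) x - b k x = d k x := by simp [b, Finset.sum_range_succ]
    rw [this]
    exact hd k x
  refine ⟨z', ((hz'.smul s).eq_iff (ha.shift c)).2 fun k x => ?_⟩
  have h₁ := neg_mem (Ideal.pow_le_pow_right (Nat.le_add_right k c) (hw (k + c) x))
  convert h₁ using 1
  simp [hb]

/-- Since `s a k ∈ I ^ k`, Artin–Rees provides a small `d k` with `s d k = s a k`; subtracting it
makes the approximation exactly annihilated by `s`. -/
theorem exists_annihilated_approximation {z : FormalComb I X} {a : ℕ → X →₀ R}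
    (ha : Represents a z) (hz : s • z = 0) :
    ∃ c, ∃ b : ℕ → X →₀ R, (∀ k, s • b k = 0) ∧ ∀ k x, a k x - b k x ∈ I ^ (k - c) := by
  obtain ⟨c, hc⟩ := exists_artinRees_span I s
  have hd (k : ℕ) : ∃ d : X →₀ R, ∀ x, d x ∈ I ^ (k - c) ∧ s * d x = s * a k x :=
    exists_finsupp_forall (a k) (fun r d => d ∈ I ^ (k - c) ∧ s * d = s * r) (by simp)
      fun x => hc k _ ((ha.smul s).eq_zero_iff.1 hz k x)
  choose d hd hd' using hd
  refine ⟨c, fun k => a k - d k, fun k => Finsupp.ext fun x => ?_, fun k x => ?_⟩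
  · simp [mul_sub, hd']
  · simpa using hd k x

/-- Surjectivity on `s`-torsion. The annihilated approximations form a `J`-adic Cauchy sequence up
to a shift, and on the annihilator of `s` this already implies `I`-adic convergence. -/
theorem exists_annihilated_lift (hJ : J = I ⊔ Ideal.span {s}) (hIJ : I ≤ J)
    {y : FormalComb J X} (hy : s • y = 0) :
    ∃ x : FormalComb I X, s • x = 0 ∧ changeIdeal hIJ X x = y := by
  obtain ⟨a, ha⟩ := exists_represents y
  obtain ⟨c, b, hb, hab⟩ := exists_annihilated_approximation ha hy
  obtain ⟨d, hd⟩ := exists_artinRees_annihilator I s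
  rw [← hJ] at hd
  have hb' : ∀ k x, s * b k x = 0 := fun k x => DFunLike.congr_fun (hb k) x
  obtain ⟨x, hx⟩ := exists_of_cauchy_shift (a := b) (I := I) (c + d) fun k x => by
    rw [← Nat.sub_sub]
    refine hd _ _ ?_ (by rw [mul_sub, hb', hb', sub_zero])
    have h₁ := Ideal.pow_le_pow_right (Nat.sub_le_sub_right k.le_succ c) (hab (k + 1) x)
    have h₂ := Ideal.pow_le_pow_right (Nat.sub_le k c) (ha.sub_mem k.le_succ x)
    convert add_mem (sub_mem (hab k x) h₁) h₂ using 1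
    simp only [Nat.succ_eq_add_one]
    ring
  refine ⟨x, (hx.smul s).eq_zero_iff.2 fun k x => ?_,
    ((hx.changeIdeal hIJ).eq_iff (ha.shift (c + d))).2 fun k x => ?_⟩
  · simp [hb']
  · have h := neg_mem (hab (k + (c + d)) x)
    rw [neg_sub] at h
    exact Ideal.pow_le_pow_right (by omega) h

/-- Injectivity on `s`-torsion, again because annihilated elements that are `J`-adically small are
`I`-adically small. -/
theorem eq_zero_of_annihilated (hJ : J = I ⊔ Ideal.span {s}) (hIJ : I ≤ J)
    {z : FormalComb I X} (hz : s • z = 0) (hz' : changeIdeal hIJ X z = 0) :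
    z = 0 := by
  obtain ⟨a, ha⟩ := exists_represents z
  obtain ⟨c, b, hb, hab⟩ := exists_annihilated_approximation ha hz
  obtain ⟨d, hd⟩ := exists_artinRees_annihilator I s
  rw [← hJ] at hd
  have haJ := (ha.changeIdeal hIJ).eq_zero_iff.1 hz'
  refine (ha.shift (c + d)).eq_zero_iff.2 fun k x => ?_
  have h₁ : b (k + (c + d)) x ∈ J ^ (k + (c + d) - c) := by
    have h := sub_mem (Ideal.pow_le_pow_right (Nat.sub_le _ c) (haJ (k + (c + d)) x))
      (Ideal.pow_right_mono hIJ _ (hab (k + (c + d)) x))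
    simpa using h
  have h₂ := hd _ _ h₁ (DFunLike.congr_fun (hb _) x)
  have h₃ := add_mem (Ideal.pow_le_pow_right (by omega) (hab (k + (c + d)) x) : _ ∈ I ^ k)
    (Ideal.pow_le_pow_right (by omega) h₂)
  simpa using h₃

/-- Injectivity modulo `s`: an error in `J ^ k` is a multiple of `s` up to `I ^ k`, so
`exists_smul_eq_of_mem` applies. -/
theorem exists_smul_eq_of_changeIdeal_eq (hJ : J = I ⊔ Ideal.span {s}) (hIJ : I ≤ J)
    {z : FormalComb I X} {y : FormalComb J X}
    (h : changeIdeal hIJ X z = s • y) : ∃ z', s • z' = z := by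
  obtain ⟨a, ha⟩ := exists_represents z
  obtain ⟨b, hb⟩ := exists_represents y
  refine exists_smul_eq_of_mem ha fun k x => ?_
  have h₁ := ((ha.changeIdeal hIJ).eq_iff (hb.smul s)).1 h k x
  rw [hJ] at h₁
  obtain ⟨v, -, hv⟩ := exists_sub_mul_mem_pow h₁
  refine ⟨b k x + v, ?_⟩
  convert hv using 1
  simp
  ring

/-- Surjectivity modulo `s`. Each increment of `a` lies in `J ^ k ⊆ I ^ k + s J ^ (k - 1)`; the
parts divisible by `s` sum `J`-adically to `y'`, and what remains converges `I`-adically. -/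
theorem exists_changeIdeal_add_smul (hJ : J = I ⊔ Ideal.span {s}) (hIJ : I ≤ J)
    (y : FormalComb J X) : ∃ z y', y = changeIdeal hIJ X z + s • y' := by
  obtain ⟨a, ha⟩ := exists_represents y
  have hv (k : ℕ) : ∃ v : X →₀ R, ∀ x, v x ∈ J ^ (k - 1) ∧
      (a (k + 1) - a k) x - s * v x ∈ I ^ k :=
    exists_finsupp_forall (a (k + 1) - a k) (fun r v => v ∈ J ^ (k - 1) ∧ r - s * v ∈ I ^ k)
      (by simp) fun x => by
        have h := ha.sub_mem k.le_succ x
        rw [hJ] at h ⊢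
        exact exists_sub_mul_mem_pow h
  choose v hv hv' using hv
  let b : ℕ → X →₀ R := fun k => ∑ j ∈ Finset.range k, v j
  have hb : ∀ k, b (k + 1) = b k + v k := fun k => Finset.sum_range_succ _ _
  obtain ⟨y', hy'⟩ := exists_of_cauchy_shift (a := b) (I := J) 1 fun k x => by
    simpa [hb] using hv k x
  obtain ⟨z, hz⟩ := exists_of_cauchy_shift (a := fun k => a k - s • b k) (I := I) 0 fun k x => by
    have h : (a (k + 1) - s • b (k + 1)) x - (a k - s • b k) x =
        (a (k + 1) - a k) x - s * v k x := by
      simp [hb]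
      ring
    rw [h]
    exact hv' k x
  refine ⟨z, y', ((ha.shift 1).eq_iff (((hz.shift 1).changeIdeal hIJ).add (hy'.smul s))).2
    fun k x => ?_⟩
  simp

variable (X) in
theorem bijective_smul_ker_changeIdeal (hJ : J = I ⊔ Ideal.span {s}) (hIJ : I ≤ J) :
    Function.Bijective fun x : LinearMap.ker (changeIdeal hIJ X) => s • x := by
  constructor
  · refine (injective_iff_map_eq_zero (LinearMap.lsmul R _ s)).2 fun x hx => ?_
    exact Subtype.ext (eq_zero_of_annihilated hJ hIJ (congrArg Subtype.val hx) x.2)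
  · rintro ⟨x, hx⟩
    obtain ⟨x', rfl⟩ := exists_smul_eq_of_changeIdeal_eq hJ hIJ
      (hx.trans (smul_zero s).symm)
    rw [LinearMap.mem_ker, _root_.map_smul] at hx
    -- The quotient `x'` may lie outside the kernel, but its image is `s`-torsion; subtracting an
    -- `s`-torsion lift of that image corrects it without changing `s • x'`.
    obtain ⟨x'', h₀, h₁⟩ := exists_annihilated_lift hJ hIJ hx
    refine ⟨⟨x' - x'', by rw [LinearMap.mem_ker, _root_.map_sub, h₁, sub_self]⟩,
      Subtype.ext ?_⟩
    change s • (x' - x'') = s • x'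
    rw [smul_sub, h₀, sub_zero]

variable (X) in
theorem bijective_smul_coker_changeIdeal (hJ : J = I ⊔ Ideal.span {s}) (hIJ : I ≤ J) :
    Function.Bijective fun x : FormalComb J X ⧸
      LinearMap.range (changeIdeal hIJ X) => s • x := by
  constructor
  · refine (injective_iff_map_eq_zero (LinearMap.lsmul R _ s)).2 fun x hx => ?_
    obtain ⟨y, rfl⟩ := Submodule.Quotient.mk_surjective _ x
    obtain ⟨z, hz⟩ := (Submodule.Quotient.mk_eq_zero _).1
      ((Submodule.Quotient.mk_smul _ _ _).trans hx)
    obtain ⟨z', rfl⟩ := exists_smul_eq_of_changeIdeal_eq hJ hIJ hz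
    rw [_root_.map_smul] at hz
    obtain ⟨z'', -, h₁⟩ := exists_annihilated_lift hJ hIJ (y := y - changeIdeal hIJ X z')
      (by rw [smul_sub, hz, sub_self])
    refine (Submodule.Quotient.mk_eq_zero _).2 ⟨z' + z'', ?_⟩
    rw [_root_.map_add, h₁, add_sub_cancel]
  · intro x
    obtain ⟨y, rfl⟩ := Submodule.Quotient.mk_surjective _ x
    obtain ⟨z, y', hy⟩ := exists_changeIdeal_add_smul hJ hIJ y
    refine ⟨Submodule.Quotient.mk y', ?_⟩
    refine (Submodule.Quotient.mk_smul _ _ _).symm.trans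
      ((Submodule.Quotient.eq _).2 ⟨-z, ?_⟩)
    rw [_root_.map_neg, hy]
    abel

end AddGenerator

/-! ### Formal combinations are indistinguishable from free modules by maps and extensions into `P`.
-/

section Free

open Abelian

theorem bijective_precomp_comp {R : Type u} [CommRing R] {A B C P : Type v} [AddCommGroup A]
    [Module R A] [AddCommGroup B] [Module R B] [AddCommGroup C] [Module R C] [AddCommGroup P]
    [Module R P] {f : A →ₗ[R] B} {g : B →ₗ[R] C}
    (hf : Function.Bijective fun h : B →ₗ[R] P => h ∘ₗ f)
    (hg : Function.Bijective fun h : C →ₗ[R] P => h ∘ₗ g) :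
    Function.Bijective fun h : C →ₗ[R] P => h ∘ₗ (g ∘ₗ f) :=
  hf.comp hg

variable {R : Type u} [CommRing R] [IsNoetherianRing R] {m : Ideal R} {P : ModuleCat.{u} R}

variable (m P) in
/-- Formal linear combinations of elements of `X` behave like a free module on `X` for
homomorphisms and extensions into `P`. -/
def IsFreeAgainst (X : Type u) : Prop :=
  (Function.Bijective fun h : FormalComb m X →ₗ[R] P => h ∘ₗ ofFinsupp m X) ∧
    ∀ i, Subsingleton (Ext.{u} (ModuleCat.of R (FormalComb m X)) P (i + 1))

theorem isFreeAgainst_bot (X : Type u) : IsFreeAgainst (⊥ : Ideal R) P X := by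
  let e : (X →₀ R) ≃ₗ[R] FormalComb (⊥ : Ideal R) X :=
    LinearEquiv.ofBijective (ofFinsupp (⊥ : Ideal R) X) ofFinsupp_bot_bijective
  refine ⟨⟨fun f g h => ?_, fun h => ⟨h ∘ₗ e.symm, ?_⟩⟩, fun i =>
    subsingleton_ext_congr e (i + 1) (subsingleton_ext_of_free i)⟩
  · refine LinearMap.ext fun x => ?_
    obtain ⟨a, rfl⟩ := ofFinsupp_bot_bijective.2 x
    exact LinearMap.congr_fun h a
  · exact LinearMap.ext fun a => congrArg h (e.symm_apply_apply a)

/-- The kernel and cokernel of `changeIdeal` have `s` invertible, so all their `Ext` groups into `P`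
vanish. -/
theorem IsFreeAgainst.sup {X : Type u} {I J : Ideal R} {s : R} (hP : UniqueTelescope s P)
    (hJ : J = I ⊔ Ideal.span {s}) (hI : IsFreeAgainst I P X) : IsFreeAgainst J P X := by
  have hIJ : I ≤ J := hJ ▸ le_sup_left
  have hK : ∀ i, Subsingleton (Ext.{u}
      (ModuleCat.of R (LinearMap.ker (changeIdeal hIJ X))) P i) := fun i =>
    hP.subsingleton_ext i (bijective_smul_ker_changeIdeal X hJ hIJ)
  have hC : ∀ i, Subsingleton (Ext.{u} (ModuleCat.of R
      (FormalComb J X ⧸ LinearMap.range (changeIdeal hIJ X))) P i) := fun i =>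
    hP.subsingleton_ext i (bijective_smul_coker_changeIdeal X hJ hIJ)
  refine ⟨?_, fun i => subsingleton_ext_of_ker_coker _ hK hC (hI.2 i)⟩
  rw [← changeIdeal_comp_ofFinsupp hIJ]
  exact bijective_precomp_comp hI.1 (bijective_precomp_of_ker_coker _ hK hC)

theorem isFreeAgainst_span (X : Type u) (hP : ∀ s ∈ m, UniqueTelescope s P) (t : Finset R)
    (ht : (t : Set R) ⊆ m) : IsFreeAgainst (Ideal.span (t : Set R)) P X := by
  classical
  induction t using Finset.induction_on with
  | empty =>
    rw [Finset.coe_empty, Ideal.span_empty]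
    exact isFreeAgainst_bot X
  | insert s t _ ih =>
    rw [Finset.coe_insert, Set.insert_subset_iff] at ht
    refine (ih ht.2).sup (hP s ht.1) ?_
    rw [Finset.coe_insert, Ideal.span_insert, sup_comm]

theorem isFreeAgainst (X : Type u) (hP : ∀ s ∈ m, UniqueTelescope s P) :
    IsFreeAgainst m P X := by
  obtain ⟨t, rfl⟩ := IsNoetherian.noetherian m
  exact isFreeAgainst_span X hP t Ideal.subset_span

theorem formalComb_hom_ext {X : Type u} (hP : ∀ s ∈ m, UniqueTelescope s P)
    {f g : FormalComb m X →ₗ[R] P} (h : ∀ x, f (single x : ZeroFam (AdicCompletion m R) X) =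
      g (single x : ZeroFam (AdicCompletion m R) X)) :
    f = g :=
  (isFreeAgainst X hP).1.1 <| Finsupp.lhom_ext' fun x => LinearMap.ext_ring <| by
    simpa [ofFinsupp_single] using h x

end Free

open Abelian Limits

/-! ### Elementary consequences of unique telescopes. -/

section Telescopes

theorem UniqueTelescope.congr {R : Type u} [CommRing R] {s : R} {P : Type v} {Q : Type w}
    [AddCommGroup P] [Module R P] [AddCommGroup Q] [Module R Q] (e : P ≃ₗ[R] Q)
    (h : UniqueTelescope s P) : UniqueTelescope s Q := by
  intro p
  obtain ⟨q, hq, hq'⟩ := h fun n => e.symm (p n)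
  refine ⟨fun n => e (q n), fun n => ?_, fun r hr => funext fun n => ?_⟩
  · rw [← _root_.map_smul, ← _root_.map_sub, hq, e.apply_symm_apply]
  · rw [← hq' (fun n => e.symm (r n)) fun n => by
      rw [← _root_.map_smul, ← _root_.map_sub, hr]]
    simp

/-- If `P` has unique telescopes for `x`, then `1 - x` acts invertibly on `P`. -/
theorem UniqueTelescope.bijective_one_sub_smul {R : Type u} [CommRing R] {x : R} {P : Type v}
    [AddCommGroup P] [Module R P] (h : UniqueTelescope x P) :
    Function.Bijective fun p : P => (1 - x) • p := by
  constructor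
  · intro p p' hp
    replace hp : (1 - x) • p = (1 - x) • p' := hp
    have h₁ := (h fun _ => (1 - x) • p).unique (y₁ := fun _ => p) (y₂ := fun _ => p')
      (fun _ => by rw [sub_smul, one_smul]) (fun _ => by rw [hp, sub_smul, one_smul])
    exact congrFun h₁ 0
  · intro p
    obtain ⟨q, hq, hq'⟩ := h fun _ => p
    -- The shift of a solution for a constant sequence is again a solution, so by uniqueness the
    -- solution is constant.
    have h₁ : q 1 = q 0 := congrFun (hq' (fun n => q (n + 1)) fun n => hq (n + 1)) 0
    refine ⟨q 0, ?_⟩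
    have h₂ := hq 0
    rw [zero_add, h₁] at h₂
    simpa only [sub_smul, one_smul] using h₂

end Telescopes

/-! ### Contramodules have unique telescopes. -/

section PowerSums

variable {R : Type u} [CommRing R] {m : Ideal R}

theorem convToZero_pow {s : R} (hs : s ∈ m) :
    ConvToZero fun k : ℕ => algebraMap R (AdicCompletion m R) s ^ k := by
  rw [ConvToZero, (hasBasis_nhds_zero m).tendsto_right_iff]
  intro n _
  rw [eventually_cofinite]
  refine (Set.finite_lt_nat n).subset fun k hk => ?_
  by_contra hkn
  refine hk ?_
  rw [← _root_.map_pow]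
  refine (mk_eq_mk_iff (r' := 0)).2 ?_
  rw [sub_zero]
  exact Ideal.pow_le_pow_right (not_lt.1 hkn) (Ideal.pow_mem_pow hs k)

/-- The sum `∑ s ^ k e_k`. -/
noncomputable def powerSum {s : R} (hs : s ∈ m) : ZeroFam (AdicCompletion m R) ℕ :=
  ⟨_, convToZero_pow hs⟩

theorem push_powerSum {s : R} (hs : s ∈ m) {X : Type v} (p : ℕ → X) :
    push p (powerSum hs) = single (p 0) +
      algebraMap R (AdicCompletion m R) s • push (fun k => p (k + 1)) (powerSum hs) := by
  refine ext_eval fun φ => ?_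
  have h (ψ : ℕ → AdicCompletion m R) : Summable fun k => (powerSum hs).1 k * ψ k :=
    ((powerSum hs).2.mul_left ψ).summable
  rw [eval_add, eval_smul, eval_push, eval_push, eval_single, eval, eval,
    (h fun k => φ (p k)).tsum_eq_zero_add, ← (h _).tsum_mul_left]
  congr 1
  · simp [powerSum]
  · exact tsum_congr fun k => by simp only [powerSum, pow_succ']; ring

theorem uniqueTelescope_of_contra (P : Contra (AdicCompletion m R)) {s : R} (hs : s ∈ m) :
    UniqueTelescope s ((forgetToBase m).obj P) := by
  let σ := algebraMap R (AdicCompletion m R) s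
  suffices h : ∀ p : ℕ → P.A, ∃! q : ℕ → P.A, ∀ n, q n - σ • q (n + 1) = p n from h
  -- This is `∑ s ^ k p (n + k)`; splitting off the term `k = 0` gives the telescope equation.
  let T (p : ℕ → P.A) (n : ℕ) : P.A := Contra.act P (push (fun k => p (n + k)) (powerSum hs))
  have hT (p : ℕ → P.A) (n : ℕ) : T p n - σ • T p (n + 1) = p n := by
    have h := congrArg (Contra.act P) (push_powerSum hs fun k => p (n + k))
    rw [Contra.act_add, Contra.act_smul, Contra.act_single] at h
    rw [sub_eq_iff_eq_add]
    refine h.trans ?_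
    simp only [T, σ, add_zero, add_assoc, add_comm 1]
  intro p
  refine ⟨T p, hT p, fun q hq => funext fun n => ?_⟩
  have h₀ : ∀ n, (q - T p) n = σ • (q - T p) (n + 1) := fun n => by
    have h := (hq n).trans (hT p n).symm
    simp only [Pi.sub_apply, smul_sub]
    rw [sub_eq_sub_iff_sub_eq_sub] at h
    exact h
  -- The difference `r` of two solutions satisfies `r n = s r (n + 1)`. Linearity of infinite sums
  -- carries this over to `T r`, and then `r n = T r n - s T r (n + 1) = 0`.
  have h₁ : T (q - T p) n = σ • T (q - T p) (n + 1) := by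
    have h := Contra.act_push_smul P σ (fun k => (q - T p) (n + 1 + k)) (powerSum hs)
    refine Eq.trans ?_ h
    refine congrArg (fun f => Contra.act P (push f (powerSum hs))) (funext fun k => ?_)
    rw [h₀, add_right_comm]
  have h₂ := hT (q - T p) n
  rw [← h₁, sub_self] at h₂
  exact (sub_eq_zero.1 h₂.symm)

end PowerSums

/-! ### Fullness, and recovery of the contramodule structure. -/

section Reconstruct

variable {R : Type u} [CommRing R] {m : Ideal R}

/-- Pushforward of formal linear combinations, as a linear map over the base ring. -/
noncomputable def pushLinear {X Y : Type u} (f : X → Y) : FormalComb m X →ₗ[R] FormalComb m Y where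
  toFun := push (𝔯 := AdicCompletion m R) f
  map_add' z w := ext_eval (𝔯 := AdicCompletion m R) fun φ => by
    refine (eval_push _ _ _).trans ((eval_add _ _ _).trans ?_)
    exact (congrArg₂ (· + ·) (eval_push _ _ _) (eval_push _ _ _)).symm.trans
      (eval_add _ _ _).symm
  map_smul' r z := ext_eval (𝔯 := AdicCompletion m R) fun φ => by
    refine (eval_push _ _ _).trans ((eval_smul _ _ _).trans ?_)
    exact (congrArg _ (eval_push _ _ _)).symm.trans (eval_smul _ _ _).symm

/-- Opening of parentheses, as a linear map over the base ring. -/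
noncomputable def joinLinear (m : Ideal R) (X : Type u) :
    FormalComb m (FormalComb m X) →ₗ[R] FormalComb m X where
  toFun := join (𝔯 := AdicCompletion m R)
  map_add' z w := ext_eval (𝔯 := AdicCompletion m R) fun φ => by
    refine (eval_join _ _).trans ((eval_add _ _ _).trans ?_)
    exact (congrArg₂ (· + ·) (eval_join _ _) (eval_join _ _)).symm.trans
      (eval_add _ _ _).symm
  map_smul' r z := ext_eval (𝔯 := AdicCompletion m R) fun φ => by
    refine (eval_join _ _).trans ((eval_smul _ _ _).trans ?_)
    exact (congrArg _ (eval_join _ _)).symm.trans (eval_smul _ _ _).symm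

/-- The contraaction map as a linear map over the base ring. -/
noncomputable def actLinear (P : Contra (AdicCompletion m R)) :
    FormalComb m P.A →ₗ[R] (forgetToBase m).obj P where
  toFun := Contra.act P
  map_add' := Contra.act_add P
  map_smul' r := Contra.act_smul P (algebraMap R (AdicCompletion m R) r)

theorem push_single {𝔯 : Type u} [CommRing 𝔯] [UniformSpace 𝔯] [IsUniformAddGroup 𝔯]
    [IsTopologicalRing 𝔯] [IsLinearTopology 𝔯 𝔯] [CompleteSpace 𝔯] [T2Space 𝔯] {X : Type v}
    {Y : Type w} (f : X → Y) (x : X) :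
    push f (single x : ZeroFam 𝔯 X) = single (f x) :=
  ext_eval fun φ => by rw [eval_push, eval_single, eval_single]

theorem join_single {𝔯 : Type u} [CommRing 𝔯] [UniformSpace 𝔯] [IsUniformAddGroup 𝔯]
    [IsTopologicalRing 𝔯] [IsLinearTopology 𝔯 𝔯] [CompleteSpace 𝔯] [T2Space 𝔯] {X : Type v}
    (z : ZeroFam 𝔯 X) : join (single z) = z :=
  ext_eval fun φ => by rw [eval_join, eval_single]

theorem join_single_add_single {𝔯 : Type u} [CommRing 𝔯] [UniformSpace 𝔯] [IsUniformAddGroup 𝔯]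
    [IsTopologicalRing 𝔯] [IsLinearTopology 𝔯 𝔯] [CompleteSpace 𝔯] [T2Space 𝔯] {X : Type v}
    (z w : ZeroFam 𝔯 X) : join (single z + single w) = z + w :=
  ext_eval fun φ => by rw [eval_join, eval_add, eval_add, eval_single, eval_single]

theorem join_smul_single {𝔯 : Type u} [CommRing 𝔯] [UniformSpace 𝔯] [IsUniformAddGroup 𝔯]
    [IsTopologicalRing 𝔯] [IsLinearTopology 𝔯 𝔯] [CompleteSpace 𝔯] [T2Space 𝔯] {X : Type v}
    (c : 𝔯) (z : ZeroFam 𝔯 X) : join (c • single z) = c • z :=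
  ext_eval fun φ => by rw [eval_join, eval_smul, eval_smul, eval_single]

variable [IsNoetherianRing R]

/-- Preservation of infinite sums is an equality of two linear maps out of formal combinations; they
agree on the basis elements, which suffices by `formalComb_hom_ext`. -/
instance : (forgetToBase m).Full where
  map_surjective {P Q} f := by
    let g : P.A → Q.A := fun p => f.hom p
    have h : f.hom ∘ₗ actLinear P = actLinear Q ∘ₗ pushLinear g :=
      formalComb_hom_ext (fun s hs => uniqueTelescope_of_contra Q hs) fun p => by
        change g (Contra.act P (single p)) = Contra.act Q (push g (single p))
        rw [push_single, Contra.act_single, Contra.act_single]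
    exact ⟨Contra.homMk g fun z => LinearMap.congr_fun h z, rfl⟩

variable {P : ModuleCat.{u} R} (hP : ∀ s ∈ m, UniqueTelescope s P)

/-- The infinite summation operation on a module with unique telescopes. -/
noncomputable def sumMap : FormalComb m P →ₗ[R] P :=
  ((isFreeAgainst P hP).1.2 (Finsupp.linearCombination R id)).choose

theorem sumMap_single (p : P) : sumMap hP (single p : ZeroFam (AdicCompletion m R) P) = p := by
  have h := ((isFreeAgainst P hP).1.2 (Finsupp.linearCombination R id)).choose_spec
  have h' := LinearMap.congr_fun h (Finsupp.single p 1)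
  rw [LinearMap.comp_apply, ofFinsupp_single, Finsupp.linearCombination_single, one_smul] at h'
  exact h'

theorem sumMap_join : sumMap hP ∘ₗ joinLinear m P = sumMap hP ∘ₗ pushLinear (sumMap hP) :=
  formalComb_hom_ext hP fun z => by
    have h₁ : joinLinear m P (single z : ZeroFam (AdicCompletion m R) (FormalComb m P)) = z :=
      join_single (𝔯 := AdicCompletion m R) z
    have h₂ : pushLinear (sumMap hP)
        (single z : ZeroFam (AdicCompletion m R) (FormalComb m P)) =
        (single (sumMap hP z) : ZeroFam (AdicCompletion m R) P) :=
      push_single (𝔯 := AdicCompletion m R) _ z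
    exact (congrArg (sumMap hP) h₁).trans
      ((sumMap_single hP _).symm.trans (congrArg (sumMap hP) h₂).symm)

/-- The contramodule structure on a module with unique telescopes. -/
noncomputable def contraOfUniqueTelescope : Contra (AdicCompletion m R) where
  A := P
  a := TypeCat.ofHom (sumMap hP)
  unit := ConcreteCategory.hom_ext _ _ fun p => sumMap_single hP p
  assoc := ConcreteCategory.hom_ext _ _ fun z => LinearMap.congr_fun (sumMap_join hP) z

theorem essImage_of_uniqueTelescope (hP : ∀ s ∈ m, UniqueTelescope s P) :
    (forgetToBase m).essImage P := by
  -- The underlying sets are equal, but the contramodule's addition and scalar action are defined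
  -- through its contraaction; linearity of `sumMap` shows that they are the original ones.
  let e : (forgetToBase m).obj (contraOfUniqueTelescope hP) ≃ₗ[R] P :=
    { toFun := fun p => p
      invFun := fun p => p
      left_inv := fun _ => rfl
      right_inv := fun _ => rfl
      map_add' := fun p q => (_root_.map_add (sumMap hP)
        (single p : ZeroFam (AdicCompletion m R) P) (single q : ZeroFam (AdicCompletion m R) P)).trans
          (congrArg₂ (· + ·) (sumMap_single hP p) (sumMap_single hP q))
      map_smul' := fun r p => (_root_.map_smul (sumMap hP) r
        (single p : ZeroFam (AdicCompletion m R) P)).trans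
          (congrArg (r • ·) (sumMap_single hP p)) }
  exact ⟨_, ⟨e.toModuleIso⟩⟩

end Reconstruct

/-! ### Comparison of the essential image with the Ext conditions. -/

section EssImage

variable {R : Type u} [CommRing R] {m : Ideal R} {P : ModuleCat.{u} R}

theorem uniqueTelescope_of_essImage (hP : (forgetToBase m).essImage P) :
    ∀ s ∈ m, UniqueTelescope s P := by
  obtain ⟨Q, ⟨e⟩⟩ := hP
  exact fun s hs => (uniqueTelescope_of_contra Q hs).congr e.toLinearEquiv

theorem bijective_smul_restrictScalars {S : Submonoid R} {s : R} (hs : s ∈ S)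
    (L : ModuleCat.{u} (Localization S)) :
    Function.Bijective fun x : (ModuleCat.restrictScalars (algebraMap R (Localization S))).obj L =>
      s • x := by
  have h : IsUnit (algebraMap R (Localization S) s) :=
    IsLocalization.map_units (Localization S) (⟨s, hs⟩ : S)
  exact (MulAction.bijective h.unit : Function.Bijective fun x : L => h.unit • x)

theorem extCondA_of_uniqueTelescope (hP : ∀ s ∈ m, UniqueTelescope s P) : ExtCondA m P := by
  rintro S ⟨s, hs, hm⟩ L i
  exact (hP s hm).subsingleton_ext i
    (L := (ModuleCat.restrictScalars (algebraMap R (Localization S))).obj L)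
    (bijective_smul_restrictScalars hs L)

/-- Restriction of scalars to the base ring of a module with compatible actions. -/
noncomputable def restrictScalarsEquiv (S : Submonoid R) (M : Type u) [AddCommGroup M]
    [Module R M] [Module (Localization S) M] [IsScalarTower R (Localization S) M] :
    (ModuleCat.restrictScalars (algebraMap R (Localization S))).obj
      (ModuleCat.of (Localization S) M) ≃ₗ[R] M where
  toFun x := x
  invFun x := x
  left_inv _ := rfl
  right_inv _ := rfl
  map_add' _ _ := rfl
  map_smul' r x := algebraMap_smul (M := M) (Localization S) r x

theorem extCondC_of_extCondA (h : ExtCondA m P) : ExtCondC m P := fun s hs i _ =>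
  subsingleton_ext_congr (restrictScalarsEquiv (Submonoid.powers s) (Localization.Away s)) i
    (h _ ⟨s, Submonoid.mem_powers s, hs⟩ (ModuleCat.of _ (Localization.Away s)) i)

theorem uniqueTelescope_of_extCondC (h : ExtCondC m P) : ∀ s ∈ m, UniqueTelescope s P :=
  fun s hs => uniqueTelescope_of_subsingleton_ext (h s hs 0 (Or.inl rfl)) (h s hs 1 (Or.inr rfl))

theorem extCondC_of_extCondB (h : ExtCondB m P) : ExtCondC m P := fun s hs i _ =>
  h _ i fun h' => Set.eq_empty_iff_forall_notMem.1 h'.1 s ⟨Submonoid.mem_powers s, hs⟩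

end EssImage

/-! ### Condition (b): multiplicative sets disjoint from a maximal ideal. -/

section Localization

variable {R : Type u} [CommRing R] (S : Submonoid R)

instance : (ModuleCat.restrictScalars.{u} (algebraMap R (Localization S))).Full where
  map_surjective {M N} f := ⟨ModuleCat.ofHom
    { toFun := f.hom
      map_add' := f.hom.map_add
      map_smul' := fun c x => by
        obtain ⟨⟨r, t⟩, h⟩ := IsLocalization.surj S c
        refine (bijective_smul_restrictScalars t.2 N).1 ?_
        have h₁ (L : ModuleCat.{u} (Localization S)) (y : L) :
            algebraMap R (Localization S) t • c • y = algebraMap R (Localization S) r • y := by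
          rw [← mul_smul, mul_comm, h]
        have h₂ := f.hom.map_smul r x
        have h₃ := f.hom.map_smul (t : R) (c • x : M)
        refine h₃.symm.trans (Eq.trans ?_ (h₁ N (f.hom x)).symm)
        exact (congrArg f.hom (h₁ M x)).trans h₂ }, rfl⟩

instance : (ModuleCat.restrictScalars.{u}
    (algebraMap R (Localization S))).PreservesInjectiveObjects where
  injective_obj {J} hJ := by
    have := ModuleCat.preservesFiniteLimits_extendScalars_of_flat
      (f := algebraMap R (Localization S))
      (RingHom.flat_algebraMap_iff.2 (IsLocalization.flat (Localization S) S))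
    exact Injective.injective_of_adjoint
      (ModuleCat.extendRestrictScalarsAdj (algebraMap R (Localization S))) J

/-- Restriction of scalars from a localization is exact, fully faithful and preserves injectives, so
`Ext` may be computed over `R[S⁻¹]`, where the source is free. -/
theorem subsingleton_ext_localization (M : ModuleCat.{u} (Localization S)) (i : ℕ) :
    Subsingleton (Ext.{u} (ModuleCat.of R (Localization S))
      ((ModuleCat.restrictScalars (algebraMap R (Localization S))).obj M) (i + 1)) := by
  have : Projective (ModuleCat.of (Localization S) (Localization S)) :=
    (IsProjective.iff_projective _).1
      (inferInstanceAs (Module.Projective (Localization S) (Localization S)))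
  have h₁ := Ext.subsingleton_of_projective.{u}
    (ModuleCat.of (Localization S) (Localization S)) M i
  have h₂ := (Functor.mapExt_bijective_of_preservesInjectiveObjects
    (ModuleCat.restrictScalars (algebraMap R (Localization S)))
    (ModuleCat.of (Localization S) (Localization S)) M (i + 1)).2.subsingleton
  exact subsingleton_ext_congr (restrictScalarsEquiv S (Localization S)) _ h₂

theorem subsingleton_ext_localization_of_bijective (P : ModuleCat.{u} R)
    (h : ∀ s ∈ S, Function.Bijective fun p : P => s • p) (i : ℕ) :
    Subsingleton (Ext.{u} (ModuleCat.of R (Localization S)) P (i + 1)) := by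
  have hl : IsLocalizedModule S (LinearMap.id : P →ₗ[R] P) :=
    { map_units := fun s => (Module.End.isUnit_iff _).2 (h s s.2)
      surj := fun y => ⟨(y, 1), one_smul _ _⟩
      exists_of_eq := fun h => ⟨1, congrArg _ h⟩ }
  let e : (ModuleCat.restrictScalars (algebraMap R (Localization S))).obj
      (ModuleCat.of (Localization S) (LocalizedModule S P)) ≃ₗ[R] P :=
    (restrictScalarsEquiv S (LocalizedModule S P)).trans
      (IsLocalizedModule.iso S (LinearMap.id : P →ₗ[R] P))
  have h₁ := subsingleton_ext_localization S (ModuleCat.of _ (LocalizedModule S P)) i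
  refine subsingleton_of_forall_eq 0 fun x => ?_
  rw [← Ext.comp_mk₀_id x, ← e.toModuleIso.inv_hom_id, ← Ext.mk₀_comp_mk₀,
    ← Ext.comp_assoc_of_third_deg_zero, h₁.elim (x.comp _ _) 0, Ext.zero_comp]

variable {S} {m : Ideal R} {P : ModuleCat.{u} R}

theorem extCondB_of_uniqueTelescope (hm : m.IsMaximal) (hP : ∀ s ∈ m, UniqueTelescope s P) :
    ExtCondB m P := by
  intro S i hi
  by_cases hS : (S : Set R) ∩ m = ∅
  · obtain ⟨i, rfl⟩ := Nat.exists_eq_succ_of_ne_zero fun h => hi ⟨hS, h⟩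
    refine subsingleton_ext_localization_of_bijective S P (fun s hs => ?_) i
    have hsm : s ∉ m := fun h => Set.eq_empty_iff_forall_notMem.1 hS s ⟨hs, h⟩
    -- Modulo the maximal ideal `s` is invertible: `t s = 1 - y` with `y ∈ m`. As `1 - y` acts
    -- bijectively on `P`, so does `s`.
    obtain ⟨t, y, hy, hty⟩ := hm.exists_inv hsm
    have h := (hP y hy).bijective_one_sub_smul
    rw [show 1 - y = t * s by rw [← hty, add_sub_cancel_right]] at h
    refine ⟨fun p q hpq => h.1 ?_, fun p => ?_⟩
    · simpa only [mul_smul] using congrArg (t • ·) hpq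
    · obtain ⟨q, hq⟩ := h.2 p
      exact ⟨t • q, by simpa only [mul_smul, smul_comm s t] using hq⟩
  · obtain ⟨s, hs, hsm⟩ := Set.nonempty_iff_ne_empty.2 hS
    exact (hP s hsm).subsingleton_ext i (bijective_smul_localization hs (Localization S))

end Localization

/-! ### Closure of the essential image, and comparison of Ext groups under exact fully faithful
functors. -/

section Closure

variable {C : Type v} [Category C] {D : Type w} [Category D] [Abelian C] [Abelian D]
  (F : C ⥤ D) [F.Full] [F.Faithful] [F.Additive] {P Q : D}

theorem essImage_biprod (hP : F.essImage P) (hQ : F.essImage Q) : F.essImage (P ⊞ Q) := by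
  obtain ⟨P', ⟨e⟩⟩ := hP
  obtain ⟨Q', ⟨e'⟩⟩ := hQ
  have := preservesBinaryBiproducts_of_preservesBiproducts F
  exact ⟨P' ⊞ Q', ⟨F.mapBiprod P' Q' ≪≫ biprod.mapIso e e'⟩⟩

theorem essImage_kernel [PreservesFiniteLimits F] (hP : F.essImage P) (hQ : F.essImage Q)
    (f : P ⟶ Q) : F.essImage (kernel f) := by
  obtain ⟨P', ⟨e⟩⟩ := hP
  obtain ⟨Q', ⟨e'⟩⟩ := hQ
  refine ⟨kernel (F.preimage (e.hom ≫ f ≫ e'.inv)), ⟨PreservesKernel.iso F _ ≪≫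
    kernel.mapIso _ _ e e' ?_⟩⟩
  simp

theorem essImage_cokernel [PreservesFiniteColimits F] (hP : F.essImage P) (hQ : F.essImage Q)
    (f : P ⟶ Q) : F.essImage (cokernel f) := by
  obtain ⟨P', ⟨e⟩⟩ := hP
  obtain ⟨Q', ⟨e'⟩⟩ := hQ
  refine ⟨cokernel (F.preimage (e.hom ≫ f ≫ e'.inv)), ⟨PreservesCokernel.iso F _ ≪≫
    cokernel.mapIso _ _ e e' ?_⟩⟩
  simp

attribute [local simp] Ext.mapExactFunctor_comp Ext.mapExactFunctor_mk₀ Ext.mapExactFunctor_extClass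

attribute [local instance] Ext.subsingleton_of_projective in
/-- An exact fully faithful functor induces isomorphisms on extension groups if there are enough
projective objects whose images have no higher extensions by the image of the functor. -/
theorem mapExt_bijective_of_acyclic [PreservesFiniteLimits F] [PreservesFiniteColimits F]
    [HasExt.{t} C] [HasExt.{t'} D] (Y : C)
    (h : ∀ X : C, ∃ p : ProjectivePresentation X, ∀ i,
      Subsingleton (Ext.{t'} (F.obj p.p) (F.obj Y) (i + 1))) (X : C) (n : ℕ) :
    Function.Bijective (F.mapExtAddHom X Y n : Ext.{t} X Y n →+ Ext.{t'} (F.obj X) (F.obj Y) n) := by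
  induction n generalizing X with
  | zero => simpa [Ext.mapExactFunctor₀] using ⟨F.map_injective, F.map_surjective⟩
  | succ n hn =>
    obtain ⟨P, hP⟩ := h X
    let S := ShortComplex.mk _ _ (kernel.condition P.f)
    have hP' : Subsingleton (Ext (S.map F).X₂ (F.obj Y) (n + 1)) := hP n
    have hS : S.ShortExact := { exact := ShortComplex.exact_kernel P.f }
    -- Dimension shifting: on both sides `Ext^(n+1)` of the projective vanishes, so `Ext^(n+1)(X,
    -- Y)` is the cokernel of `Ext^n` of the projective mapping to `Ext^n` of the kernel, where the
    -- induction hypothesis applies.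
    exact AddMonoidHom.bijective_of_surjective_of_bijective_of_right_exact _ _ _ _
      (F.mapExtAddHom S.X₂ Y n) (F.mapExtAddHom S.X₁ Y n) (F.mapExtAddHom S.X₃ Y (n + 1))
      (by cat_disch) (by cat_disch)
      ((ShortComplex.ab_exact_iff_function_exact _).1
        (Ext.contravariant_sequence_exact₁' hS Y n (n + 1) (add_comm 1 n)))
      ((ShortComplex.ab_exact_iff_function_exact _).1
        (Ext.contravariant_sequence_exact₁' (hS.map F) (F.obj Y) n (n + 1) (add_comm 1 n)))
      (hn _).surjective (hn _)
      (fun x₃ ↦ Ext.contravariant_sequence_exact₃ hS _ x₃ (by subsingleton) (add_comm 1 n))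
      (fun y₃ ↦ Ext.contravariant_sequence_exact₃ (hS.map F) _ y₃ (by subsingleton) (add_comm 1 n))

end Closure

/-! ### Free contramodules as acyclic projectives. -/

section FreeContra

variable {R : Type u} [CommRing R] {m : Ideal R}

theorem epi_iff_surjective {𝔯 : Type u} [CommRing 𝔯] [UniformSpace 𝔯] [IsUniformAddGroup 𝔯]
    [IsTopologicalRing 𝔯] [IsLinearTopology 𝔯 𝔯] [CompleteSpace 𝔯] [T2Space 𝔯] {P Q : Contra 𝔯}
    (f : P ⟶ Q) : Epi f ↔ Function.Surjective f.f :=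
  ⟨fun _ => (ModuleCat.epi_iff_surjective ((contraForget 𝔯).map f)).1 inferInstance,
    fun h => (contraForget 𝔯).epi_of_epi_map ((ModuleCat.epi_iff_surjective _).2 h)⟩

/-- This makes free contramodules projective: a left adjoint of a functor preserving epimorphisms
preserves projectives, and every set is projective. -/
instance {𝔯 : Type u} [CommRing 𝔯] [UniformSpace 𝔯] [IsUniformAddGroup 𝔯]
    [IsTopologicalRing 𝔯] [IsLinearTopology 𝔯 𝔯] [CompleteSpace 𝔯] [T2Space 𝔯] :
    (contraMonad 𝔯).forget.PreservesEpimorphisms where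
  preserves f _ := (CategoryTheory.epi_iff_surjective _).2 ((epi_iff_surjective f).1 inferInstance)

/-- The presentation of a contramodule by the free contramodule on its elements. -/
noncomputable def freePresentation {𝔯 : Type u} [CommRing 𝔯] [UniformSpace 𝔯]
    [IsUniformAddGroup 𝔯] [IsTopologicalRing 𝔯] [IsLinearTopology 𝔯 𝔯] [CompleteSpace 𝔯]
    [T2Space 𝔯] (P : Contra 𝔯) : ProjectivePresentation P where
  p := (contraMonad 𝔯).free.obj P.A
  projective := (contraMonad 𝔯).adj.map_projective _ inferInstance
  f := Contra.homMk (P := (contraMonad 𝔯).free.obj P.A) (Contra.act P) (Contra.act_join P)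
  epi := (epi_iff_surjective _).2 (Contra.act_surjective P)

/-- The module underlying a free contramodule. -/
noncomputable def freeEquiv (X : Type u) :
    FormalComb m X ≃ₗ[R]
      (forgetToBase m).obj ((contraMonad (AdicCompletion m R)).free.obj X) where
  toFun z := z
  invFun z := z
  left_inv _ := rfl
  right_inv _ := rfl
  map_add' z w := (join_single_add_single (𝔯 := AdicCompletion m R) z w).symm
  map_smul' _ z := (join_smul_single (𝔯 := AdicCompletion m R) _ z).symm

theorem subsingleton_ext_freePresentation [IsNoetherianRing R]
    (P Q : Contra (AdicCompletion m R)) (i : ℕ) :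
    Subsingleton (Ext.{u} ((forgetToBase m).obj (freePresentation P).p)
      ((forgetToBase m).obj Q) (i + 1)) :=
  subsingleton_ext_congr (freeEquiv P.A) (i + 1)
    ((isFreeAgainst P.A fun _ hs => uniqueTelescope_of_contra Q hs).2 i)

end FreeContra

end Contramodule

theorem mainTheorem12 (R : Type u) [CommRing R] [IsNoetherianRing R] (m : Ideal R) :
    -- the forgetful functor is fully faithful
    ((Contramodule.forgetToBase m).Full ∧ (Contramodule.forgetToBase m).Faithful) ∧
    -- its image is described by each of the Ext conditions
    (∀ P : ModuleCat.{u} R,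
      [(Contramodule.forgetToBase m).essImage P, Contramodule.ExtCondA m P,
        Contramodule.ExtCondC m P].TFAE ∧
      (m.IsMaximal → ((Contramodule.forgetToBase m).essImage P ↔ Contramodule.ExtCondB m P))) ∧
    -- its image is an abelian subcategory
    ((Contramodule.forgetToBase m).essImage (ModuleCat.of R PUnit) ∧
      (∀ P Q : ModuleCat.{u} R, (Contramodule.forgetToBase m).essImage P →
        (Contramodule.forgetToBase m).essImage Q →
        (Contramodule.forgetToBase m).essImage (P ⊞ Q) ∧
        ∀ f : P ⟶ Q, (Contramodule.forgetToBase m).essImage (Limits.kernel f) ∧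
          (Contramodule.forgetToBase m).essImage (Limits.cokernel f))) ∧
    -- the induced maps on Ext groups are isomorphisms
    (∀ (P Q : Contramodule.Contra (AdicCompletion m R)) (i : ℕ),
      Function.Bijective ((Contramodule.forgetToBase m).mapExtAddHom P Q i :
        Abelian.Ext.{u + 1} P Q i →+
          Abelian.Ext.{u} ((Contramodule.forgetToBase m).obj P)
            ((Contramodule.forgetToBase m).obj Q) i)) := by
  open Contramodule in
  refine ⟨⟨inferInstance, inferInstance⟩, fun P => ⟨?_, fun hm => ⟨fun h => ?_, fun h => ?_⟩⟩,
    ⟨?_, fun P Q hP hQ => ⟨essImage_biprod _ hP hQ, fun f => ⟨essImage_kernel _ hP hQ f,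
      essImage_cokernel _ hP hQ f⟩⟩⟩, fun P Q i => ?_⟩
  · tfae_have 1 → 2 := fun h => extCondA_of_uniqueTelescope (uniqueTelescope_of_essImage h)
    tfae_have 2 → 3 := extCondC_of_extCondA
    tfae_have 3 → 1 := fun h => essImage_of_uniqueTelescope (uniqueTelescope_of_extCondC h)
    tfae_finish
  · exact extCondB_of_uniqueTelescope hm (uniqueTelescope_of_essImage h)
  · exact essImage_of_uniqueTelescope (uniqueTelescope_of_extCondC (extCondC_of_extCondB h))
  · exact essImage_of_uniqueTelescope fun s _ p => ⟨0, fun n => Subsingleton.elim _ _,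
      fun q _ => funext fun n => Subsingleton.elim _ _⟩
  · exact mapExt_bijective_of_acyclic _ Q
      (fun P => ⟨freePresentation P, subsingleton_ext_freePresentation P Q⟩) P i
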